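/- Fix $n\in\mathbb N$ and $\hbar>0$. On $L^2(\mathbb R^n)$ let $\hat q_i$ be multiplication by $x_i$ and $\hat p_i=-i\hbar\,\partial_i$ (weak derivative), each on its maximal domain, and let $\hat z_1,\dots,\hat z_{2n}$ denote these canonical operators; let $z_1,\dots,z_{2n}$ be the corresponding coordinates of a phase-space point $\mathbf z=(q,p)\in\mathbb R^{2n}$. Let $\Sigma$ be the real antisymmetric $2n\times 2n$ matrix with $\Sigma_{q_ip_i}=-1$, $\Sigma_{p_iq_i}=1$ and all other entries zero. A quantum state is a positive operator $\rho$ on $L^2(\mathbb R^n)$ with $\mathrm{Tr}\,\rho=1$. It has finite second moments if every $\hat z_i\sqrt\rho$ is everywhere defined and Hilbert--Schmidt; then its means and covariance matrix are $$d_i(\rho)=\mathrm{Tr}(\rho\hat z_i),\qquad \gamma_{ij}(\rho)=2\,\mathrm{Re}\,\mathrm{Tr}\bigl(\rho(\hat z_i-d_i)(\hat z_j-d_j)\bigr),$$ where $\mathrm{Tr}(\rho X)$ and $\mathrm{Tr}(\rho XY)$ are understood as $\mathrm{Tr}\bigl(\sqrt\rho\,(X\sqrt\rho)\bigr)$ and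 $\mathrm{Tr}\bigl((X\sqrt\rho)^\dagger(Y\sqrt\rho)\bigr)$. Its Wigner function is $$W_\rho(q,p)=\mathrm{Tr}(\rho A_{(q,p)}),\qquad A_{(q,p)}=\frac1{(2\pi\hbar)^n}\int_{\mathbb R^n}dy\;e^{-ip\cdot y/\hbar}\,\bigl|q-\tfrac12y\bigr\rangle\bigl\langle q+\tfrac12y\bigr|,$$ that is, $(A_{(q,p)}\psi)(x)=(\pi\hbar)^{-n}e^{2ip\cdot(x-q)/\hbar}\psi(2q-x)$. For a real function $\mu$ on phase space such that $\mu$, $z_i\mu$ and $z_iz_j\mu$ are integrable for all $i,j$ (finite second moments), put $\langle f\rangle_\mu=\int d\mathbf z\,\mu(\mathbf z)f(\mathbf z)$, $d_i(\mu)=\langle z_i\rangle_\mu$ and $\gamma_{ij}(\mu)=2\langle(z_i-d_i(\mu))(z_j-d_j(\mu))\rangle_\mu$. **Lemma.** (1) Let $\rho$ be a quantum state whose Wigner function $W_\rho$ has finite second moments. Then $\rho$ has finite second moments, and for all $i,j$ $$d_i(\rho)=d_i(W_\rho),\qquad \gamma_{ij}(\rho)=\gamma_{ij}(W_\rho).$$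 (2) Let $\rho$ be a Gaussian state, i.e. a quantum state with $W_\rho(\mathbf z)=c\,e^{-\frac12(\mathbf z-\mathbf d)^TM(\mathbf z-\mathbf d)}$ for some $c\in\mathbb R$, $\mathbf d\in\mathbb R^{2n}$ and some real symmetric positive definite matrix $M$. Then $W_\rho$ satisfies the classical uncertainty principle with $\bar\lambda=\hbar$: $W_\rho$ is a probability density on phase space with finite second moments, and the Hermitian matrix $\gamma(W_\rho)+i\hbar\Sigma$ is positive semidefinite. -/

import Mathlib

open MeasureTheory
open scoped ComplexConjugate ComplexOrder InnerProductSpace ContDiff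

noncomputable section

namespace WignerCovariance

/-! ### Spaces -/

/-- Configuration space `ℝⁿ`. -/
abbrev Config (n : ℕ) : Type := EuclideanSpace ℝ (Fin n)

/-- Phase space `ℝ²ⁿ`; a point is `z = (q, p)`. Canonical coordinates and operators are indexed by
`Fin n ⊕ Fin n`: `Sum.inl i` is the position `qᵢ` and `Sum.inr i` is the momentum `pᵢ`. -/
abbrev PhaseSpace (n : ℕ) : Type := Config n × Config n

/-- The canonical coordinate functions on phase space. -/
def coord {n : ℕ} (i : Fin n ⊕ Fin n) (z : PhaseSpace n) : ℝ :=
  Sum.elim (fun j => z.1 j) (fun j => z.2 j) i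

/-- The Hilbert space `L²(ℝⁿ)` of wave functions. -/
abbrev WaveSpace (n : ℕ) : Type := Lp ℂ 2 (volume : Measure (Config n))

/-! ### Trace and density operators -/

/-- The index set of a Hilbert basis of `L²(ℝⁿ)`. -/
def basisIndex (n : ℕ) : Set (WaveSpace n) :=
  Classical.choose (exists_hilbertBasis ℂ (WaveSpace n))

/-- A Hilbert basis of `L²(ℝⁿ)`, used to compute traces. -/
def waveBasis (n : ℕ) : HilbertBasis (basisIndex n) ℂ (WaveSpace n) :=
  Classical.choose (Classical.choose_spec (exists_hilbertBasis ℂ (WaveSpace n)))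

/-- The trace of a (trace class) operator. -/
def opTrace {n : ℕ} (T : WaveSpace n →L[ℂ] WaveSpace n) : ℂ :=
  ∑' k, ⟪waveBasis n k, T (waveBasis n k)⟫_ℂ

/-- A quantum state: a positive operator whose trace converges and equals one. -/
def IsDensityOperator {n : ℕ} (ρ : WaveSpace n →L[ℂ] WaveSpace n) : Prop :=
  ρ.IsPositive ∧ HasSum (fun k => ⟪waveBasis n k, ρ (waveBasis n k)⟫_ℂ) 1

/-! ### Canonical operators -/

/-- The graph of the position operator: `φ = xᵢ ψ`, on the maximal domain. -/
def positionGraph {n : ℕ} (i : Fin n) : Submodule ℂ (WaveSpace n × WaveSpace n) where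
  carrier := {u | ∀ᵐ x ∂(volume : Measure (Config n)), u.2 x = (x i : ℂ) * u.1 x}
  zero_mem' := by
    filter_upwards [Lp.coeFn_zero ℂ 2 (volume : Measure (Config n))] with x hx
    simp
  add_mem' := by
    intro u v hu hv
    filter_upwards [hu, hv, Lp.coeFn_add u.1 v.1, Lp.coeFn_add u.2 v.2] with x h1 h2 h3 h4
    simp only [Prod.fst_add, Prod.snd_add, h3, h4, Pi.add_apply, h1, h2]
    ring
  smul_mem' := by
    intro c u hu
    filter_upwards [hu, Lp.coeFn_smul c u.1, Lp.coeFn_smul c u.2] with x h1 h3 h4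
    simp only [Prod.smul_fst, Prod.smul_snd, h3, h4, Pi.smul_apply, h1, smul_eq_mul]
    ring

/-- A square integrable function times a continuous compactly supported one is integrable. -/
theorem integrable_smul_wave {n : ℕ} {η : Config n → ℝ} (hη : Continuous η)
    (hs : HasCompactSupport η) (ψ : WaveSpace n) : Integrable (fun x => η x • ψ x) :=
  ((Lp.memLp ψ).locallyIntegrable (by norm_num)).integrable_smul_left_of_hasCompactSupport hη hs

/-- The partial derivative `∂η/∂xᵢ`. -/
def partialDeriv {n : ℕ} (i : Fin n) (η : Config n → ℝ) (x : Config n) : ℝ :=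
  fderiv ℝ η x (EuclideanSpace.single i 1)

theorem integrable_partialDeriv_smul_wave {n : ℕ} {i : Fin n} {η : Config n → ℝ}
    (hη : ContDiff ℝ ∞ η) (hs : HasCompactSupport η) (ψ : WaveSpace n) :
    Integrable (fun x => partialDeriv i η x • ψ x) := by
  refine integrable_smul_wave ?_ ?_ ψ
  · exact (hη.continuous_fderiv (by simp)).clm_apply continuous_const
  · exact hs.fderiv_apply ℝ _

/-- The graph of the momentum operator: `φ = -iħ ∂ψ/∂xᵢ` in the weak sense, on the maximal
domain. -/
def momentumGraph {n : ℕ} (ħ : ℝ) (i : Fin n) : Submodule ℂ (WaveSpace n × WaveSpace n) where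
  carrier := {u | ∀ η : Config n → ℝ, ContDiff ℝ ∞ η → HasCompactSupport η →
    ∫ x, η x • u.2 x = Complex.I * ħ * ∫ x, partialDeriv i η x • u.1 x}
  zero_mem' := by
    intro η _ _
    have h : ∀ f : Config n → ℝ, ∫ x, f x • (0 : WaveSpace n) x = 0 := fun f => by
      rw [integral_congr_ae (g := fun _ => (0 : ℂ))]
      · simp
      · filter_upwards [Lp.coeFn_zero ℂ 2 (volume : Measure (Config n))] with x hx
        simp
    simp only [Prod.fst_zero, Prod.snd_zero, h, mul_zero]
  add_mem' := by
    intro u v hu hv η hη hs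
    have h : ∀ (f : Config n → ℝ) (a b : WaveSpace n), Integrable (fun x => f x • a x) →
        Integrable (fun x => f x • b x) →
        ∫ x, f x • (a + b) x = (∫ x, f x • a x) + ∫ x, f x • b x := fun f a b ha hb => by
      rw [← integral_add ha hb]
      refine integral_congr_ae ?_
      filter_upwards [Lp.coeFn_add a b] with x hx
      simp only [hx, Pi.add_apply, smul_add]
    rw [Prod.fst_add, Prod.snd_add, h _ _ _ (integrable_smul_wave hη.continuous hs _)
      (integrable_smul_wave hη.continuous hs _),
      h _ _ _ (integrable_partialDeriv_smul_wave hη hs _)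
      (integrable_partialDeriv_smul_wave hη hs _), hu η hη hs, hv η hη hs, mul_add]
  smul_mem' := by
    intro c u hu η hη hs
    have h : ∀ (f : Config n → ℝ) (a : WaveSpace n),
        ∫ x, f x • (c • a) x = c * ∫ x, f x • a x := fun f a => by
      rw [← integral_const_mul]
      refine integral_congr_ae ?_
      filter_upwards [Lp.coeFn_smul c a] with x hx
      simp only [hx, Pi.smul_apply, smul_eq_mul, Complex.real_smul]
      ring
    rw [Prod.smul_fst, Prod.smul_snd, h, h, hu η hη hs]
    ring

/-- The graph of the canonical operator `ẑᵢ`. -/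
def canonicalGraph {n : ℕ} (ħ : ℝ) (i : Fin n ⊕ Fin n) :
    Submodule ℂ (WaveSpace n × WaveSpace n) :=
  Sum.elim positionGraph (momentumGraph ħ) i

/-- The canonical operators `ẑᵢ` (positions `q̂ᵢ` and momenta `p̂ᵢ = -iħ ∂ᵢ`), unbounded operators
on `L²(ℝⁿ)` with their maximal domains. -/
def canonicalOp {n : ℕ} (ħ : ℝ) (i : Fin n ⊕ Fin n) : WaveSpace n →ₗ.[ℂ] WaveSpace n :=
  (canonicalGraph ħ i).toLinearPMap

/-- The graph of `ẑᵢ` is single valued. -/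
theorem canonicalGraph_single_valued {n : ℕ} (ħ : ℝ) (i : Fin n ⊕ Fin n)
    (u : WaveSpace n × WaveSpace n) (hu : u ∈ canonicalGraph ħ i) (h0 : u.1 = 0) : u.2 = 0 := by
  rw [Lp.eq_zero_iff_ae_eq_zero]
  have hz : ∀ᵐ x ∂(volume : Measure (Config n)), u.1 x = 0 := by
    rw [h0]; exact Lp.coeFn_zero ℂ 2 _
  rcases i with i | i
  · have hu' : ∀ᵐ x ∂(volume : Measure (Config n)), u.2 x = (x i : ℂ) * u.1 x := hu
    filter_upwards [hu', hz] with x h1 h2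
    simp [h1, h2]
  · refine ae_eq_zero_of_integral_contDiff_smul_eq_zero
      ((Lp.memLp u.2).locallyIntegrable (by norm_num)) fun η hη hs => ?_
    have hu' : ∫ x, η x • u.2 x = Complex.I * ħ * ∫ x, partialDeriv i η x • u.1 x := hu η hη hs
    rw [hu', integral_congr_ae (g := fun _ => (0 : ℂ))]
    · simp
    · filter_upwards [hz] with x hx
      simp [hx]

/-- `canonicalOp` is the operator with the prescribed graph. -/
theorem canonicalOp_graph {n : ℕ} (ħ : ℝ) (i : Fin n ⊕ Fin n) :
    (canonicalOp (n := n) ħ i).graph = canonicalGraph ħ i :=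
  Submodule.toLinearPMap_graph_eq _ fun u hu h0 => canonicalGraph_single_valued ħ i u hu h0

open Classical in
/-- `ẑᵢ ψ`, extended by zero outside the domain of `ẑᵢ`. -/
def canonicalApply {n : ℕ} (ħ : ℝ) (i : Fin n ⊕ Fin n) (ψ : WaveSpace n) : WaveSpace n :=
  if h : ψ ∈ (canonicalOp ħ i).domain then canonicalOp ħ i ⟨ψ, h⟩ else 0

/-! ### Means and covariance matrix of a quantum state

For unbounded operators, `Tr(ρ X) = Tr(√ρ X √ρ)` and
`Tr(ρ X Y) = Tr((X √ρ)† (Y √ρ))` are computed with the square root of `ρ`. -/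

/-- The positive square root `√T` of a positive operator on a Hilbert space. -/
def opSqrt {H : Type*} [NormedAddCommGroup H] [InnerProductSpace ℂ H] [CompleteSpace H]
    (T : H →L[ℂ] H) : H →L[ℂ] H :=
  CFC.sqrt T

/-- The columns `√ρ eₖ` of the square root of `ρ`. -/
def sqrtCol {n : ℕ} (ρ : WaveSpace n →L[ℂ] WaveSpace n) (k : basisIndex n) : WaveSpace n :=
  opSqrt ρ (waveBasis n k)

/-- `Tr(ρ ẑᵢ²) < ∞` for all `i`: the operators `ẑᵢ √ρ` are everywhere defined and
Hilbert--Schmidt. -/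
def QuantumSecondMomentsFinite {n : ℕ} (ħ : ℝ) (ρ : WaveSpace n →L[ℂ] WaveSpace n) : Prop :=
  ∀ i : Fin n ⊕ Fin n, (∀ ψ : WaveSpace n, opSqrt ρ ψ ∈ (canonicalOp ħ i).domain) ∧
    Summable fun k => ‖canonicalApply ħ i (sqrtCol ρ k)‖ ^ 2

/-- The means `dᵢ(ρ) = Tr(ρ ẑᵢ)`. -/
def quantumMean {n : ℕ} (ħ : ℝ) (ρ : WaveSpace n →L[ℂ] WaveSpace n) (i : Fin n ⊕ Fin n) : ℂ :=
  ∑' k, ⟪sqrtCol ρ k, canonicalApply ħ i (sqrtCol ρ k)⟫_ℂ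

/-- `(ẑᵢ - dᵢ(ρ)) √ρ eₖ`. -/
def centeredCol {n : ℕ} (ħ : ℝ) (ρ : WaveSpace n →L[ℂ] WaveSpace n) (i : Fin n ⊕ Fin n)
    (k : basisIndex n) : WaveSpace n :=
  canonicalApply ħ i (sqrtCol ρ k) - quantumMean ħ ρ i • sqrtCol ρ k

/-- The covariance matrix `γᵢⱼ(ρ) = 2 Re Tr(ρ (ẑᵢ - dᵢ)(ẑⱼ - dⱼ))`. -/
def quantumCov {n : ℕ} (ħ : ℝ) (ρ : WaveSpace n →L[ℂ] WaveSpace n) :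
    Matrix (Fin n ⊕ Fin n) (Fin n ⊕ Fin n) ℝ :=
  Matrix.of fun i j => 2 * (∑' k, ⟪centeredCol ħ ρ i k, centeredCol ħ ρ j k⟫_ℂ).re

/-! ### The Wigner function -/

/-- The function `(A_z ψ)(x) = (πħ)⁻ⁿ exp(2i p·(x - q)/ħ) ψ(2q - x)`. -/
def wignerKernelFun {n : ℕ} (ħ : ℝ) (z : PhaseSpace n) (ψ : Config n → ℂ) (x : Config n) : ℂ :=
  (((Real.pi * ħ) ^ n)⁻¹ : ℝ) *
    (Complex.exp (Complex.I * ((2 * ⟪z.2, x - z.1⟫_ℝ / ħ : ℝ) : ℂ)) * ψ ((2 : ℝ) • z.1 - x))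

theorem norm_wignerKernelFun {n : ℕ} (ħ : ℝ) (z : PhaseSpace n) (ψ : Config n → ℂ)
    (x : Config n) : ‖wignerKernelFun ħ z ψ x‖ =
      |((Real.pi * ħ) ^ n)⁻¹| * ‖ψ ((2 : ℝ) • z.1 - x)‖ := by
  rw [wignerKernelFun, norm_mul, norm_mul, mul_comm Complex.I, Complex.norm_exp_ofReal_mul_I,
    one_mul, Complex.norm_real, Real.norm_eq_abs]

theorem memLp_wignerKernelFun {n : ℕ} (ħ : ℝ) (z : PhaseSpace n) (ψ : WaveSpace n) :
    MemLp (wignerKernelFun ħ z ψ) 2 (volume : Measure (Config n)) := by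
  have hmp := Measure.measurePreserving_sub_left (volume : Measure (Config n)) ((2 : ℝ) • z.1)
  have h : MemLp (fun x => ψ ((2 : ℝ) • z.1 - x)) 2 (volume : Measure (Config n)) :=
    (Lp.memLp ψ).comp_measurePreserving hmp
  refine (h.const_mul (((Real.pi * ħ) ^ n)⁻¹ : ℂ)).of_le ?_ ?_
  · refine AEStronglyMeasurable.const_mul (AEStronglyMeasurable.mul ?_ h.1) _
    exact Continuous.aestronglyMeasurable (by fun_prop)
  · filter_upwards with x
    rw [norm_wignerKernelFun, norm_mul]
    refine le_of_eq ?_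
    congr 1
    rw [← Real.norm_eq_abs, ← Complex.norm_real]
    push_cast
    rfl

theorem wignerKernelFun_congr {n : ℕ} (ħ : ℝ) (z : PhaseSpace n) {f g : Config n → ℂ}
    (h : f =ᵐ[volume] g) : wignerKernelFun ħ z f =ᵐ[volume] wignerKernelFun ħ z g := by
  have hmp := Measure.measurePreserving_sub_left (volume : Measure (Config n)) ((2 : ℝ) • z.1)
  filter_upwards [hmp.quasiMeasurePreserving.ae_eq_comp h] with x hx
  have hx' : f ((2 : ℝ) • z.1 - x) = g ((2 : ℝ) • z.1 - x) := hx
  simp only [wignerKernelFun, hx']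

/-- The phase point operator
`A_z = (2πħ)⁻ⁿ ∫ dy exp(-i p·y/ħ) |q - y/2⟩⟨q + y/2|`, a bounded operator on `L²(ℝⁿ)`;
see `inner_phasePointOp`. -/
def phasePointOp {n : ℕ} (ħ : ℝ) (z : PhaseSpace n) : WaveSpace n →L[ℂ] WaveSpace n :=
  LinearMap.mkContinuous
    { toFun := fun ψ => (memLp_wignerKernelFun ħ z ψ).toLp _
      map_add' := fun ψ φ => by
        rw [← MemLp.toLp_add, MemLp.toLp_eq_toLp_iff]
        refine (wignerKernelFun_congr ħ z (Lp.coeFn_add ψ φ)).trans (.of_forall fun x => ?_)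
        simp only [wignerKernelFun, Pi.add_apply]
        ring
      map_smul' := fun c ψ => by
        rw [RingHom.id_apply, ← MemLp.toLp_const_smul, MemLp.toLp_eq_toLp_iff]
        refine (wignerKernelFun_congr ħ z (Lp.coeFn_smul c ψ)).trans (.of_forall fun x => ?_)
        simp only [wignerKernelFun, Pi.smul_apply, smul_eq_mul]
        ring }
    |((Real.pi * ħ) ^ n)⁻¹|
    (fun ψ => by
      have hmp :=
        Measure.measurePreserving_sub_left (volume : Measure (Config n)) ((2 : ℝ) • z.1)
      rw [← Lp.norm_compMeasurePreserving ψ hmp]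
      refine Lp.norm_le_mul_norm_of_ae_le_mul ?_
      filter_upwards [MemLp.coeFn_toLp (memLp_wignerKernelFun ħ z ψ),
        Lp.coeFn_compMeasurePreserving ψ hmp] with x h1 h2
      refine le_of_eq ?_
      rw [h2]
      refine Eq.trans ?_ (norm_wignerKernelFun ħ z ψ x)
      exact congrArg _ h1)

/-- The matrix elements of the phase point operator. -/
theorem inner_phasePointOp {n : ℕ} (ħ : ℝ) (z : PhaseSpace n) (φ ψ : WaveSpace n) :
    ⟪φ, phasePointOp ħ z ψ⟫_ℂ = (((2 * Real.pi * ħ) ^ n)⁻¹ : ℝ) *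
      ∫ y : Config n, Complex.exp (-(Complex.I * ((⟪z.2, y⟫_ℝ / ħ : ℝ) : ℂ))) *
        (conj (φ (z.1 - (1 / 2 : ℝ) • y)) * ψ (z.1 + (1 / 2 : ℝ) • y)) := by
  have h1 : ⟪φ, phasePointOp ħ z ψ⟫_ℂ = ∫ x, wignerKernelFun ħ z ψ x * conj (φ x) := by
    rw [L2.inner_def]
    refine integral_congr_ae ?_
    filter_upwards [MemLp.coeFn_toLp (memLp_wignerKernelFun ħ z ψ)] with x hx
    rw [RCLike.inner_apply]
    exact congrArg (· * conj (φ x)) hx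
  have h2 := Measure.integral_comp_smul (volume : Measure (Config n))
    (fun x => wignerKernelFun ħ z ψ (z.1 - x) * conj (φ (z.1 - x))) (1 / 2 : ℝ)
  rw [integral_sub_left_eq_self (fun x => wignerKernelFun ħ z ψ x * conj (φ x)) volume z.1,
    ← h1, finrank_euclideanSpace_fin, one_div, inv_pow, inv_inv, abs_of_pos (by positivity)] at h2
  have h3 : ⟪φ, phasePointOp ħ z ψ⟫_ℂ = ((2 : ℂ) ^ n)⁻¹ *
      ∫ y : Config n, wignerKernelFun ħ z ψ (z.1 - (2⁻¹ : ℝ) • y) *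
        conj (φ (z.1 - (2⁻¹ : ℝ) • y)) := by
    rw [h2, Complex.real_smul]
    push_cast
    rw [inv_mul_cancel_left₀ (by positivity)]
  rw [h3, ← integral_const_mul, ← integral_const_mul]
  refine integral_congr_ae (.of_forall fun y => ?_)
  have e1 : (2 : ℝ) • z.1 - (z.1 - (2⁻¹ : ℝ) • y) = z.1 + (2⁻¹ : ℝ) • y := by
    rw [two_smul]; abel
  have e2 : (2 * ⟪z.2, z.1 - (2⁻¹ : ℝ) • y - z.1⟫_ℝ / ħ : ℝ) = -(⟪z.2, y⟫_ℝ / ħ) := by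
    rw [sub_right_comm, sub_self, zero_sub, inner_neg_right, inner_smul_right]
    ring
  simp only [wignerKernelFun, e1, e2, one_div]
  push_cast
  rw [mul_neg, mul_assoc (2 : ℂ), mul_pow 2, mul_inv]
  ring

/-- The Wigner function `W_ρ(z) = Tr(ρ A_z)`; the trace is real, so nothing is lost by taking the
real part. -/
def wigner {n : ℕ} (ħ : ℝ) (ρ : WaveSpace n →L[ℂ] WaveSpace n) (z : PhaseSpace n) : ℝ :=
  (opTrace (ρ ∘L phasePointOp ħ z)).re

/-! ### Functions on phase space -/

/-- Classical expectation values `⟨f⟩_μ = ∫ dz μ(z) f(z)`. -/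
def classicalExpect {n : ℕ} (μ : PhaseSpace n → ℝ) (f : PhaseSpace n → ℝ) : ℝ :=
  ∫ z : PhaseSpace n, μ z * f z

/-- The integrals that define total mass, means and covariances of `μ` converge absolutely. -/
def ClassicalSecondMomentsFinite {n : ℕ} (μ : PhaseSpace n → ℝ) : Prop :=
  Integrable μ ∧ (∀ i, Integrable fun z => μ z * coord i z) ∧
    ∀ i j, Integrable fun z => μ z * (coord i z * coord j z)

/-- The means `dᵢ(μ) = ⟨zᵢ⟩_μ`. -/
def classicalMean {n : ℕ} (μ : PhaseSpace n → ℝ) (i : Fin n ⊕ Fin n) : ℝ :=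
  classicalExpect μ (coord i)

/-- The covariance matrix `γᵢⱼ(μ) = 2 ⟨(zᵢ - dᵢ)(zⱼ - dⱼ)⟩_μ`. -/
def classicalCov {n : ℕ} (μ : PhaseSpace n → ℝ) : Matrix (Fin n ⊕ Fin n) (Fin n ⊕ Fin n) ℝ :=
  Matrix.of fun i j => 2 * classicalExpect μ fun z =>
    (coord i z - classicalMean μ i) * (coord j z - classicalMean μ j)

/-- Liouville distributions: probability densities on phase space. -/
def IsLiouvilleDistribution {n : ℕ} (μ : PhaseSpace n → ℝ) : Prop :=
  (∀ z, 0 ≤ μ z) ∧ Integrable μ ∧ ∫ z, μ z = 1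

/-- The classical uncertainty principle `γ(μ) + i ƛ Σ ≥ 0` for a Liouville distribution `μ`; the
matrix `Σ` is `Matrix.J`, with `Σ_{qᵢ pᵢ} = -1` and `Σ_{pᵢ qᵢ} = 1`. -/
def ClassicalUncertaintyPrinciple {n : ℕ} (lam : ℝ) (μ : PhaseSpace n → ℝ) : Prop :=
  IsLiouvilleDistribution μ ∧ ClassicalSecondMomentsFinite μ ∧
    ((classicalCov μ).map Complex.ofReal +
      (Complex.I * (lam : ℂ)) • Matrix.J (Fin n) ℂ).PosSemidef

/-- Gaussian states: the Wigner function is a Gaussian function on phase space. -/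
def IsGaussianState {n : ℕ} (ħ : ℝ) (ρ : WaveSpace n →L[ℂ] WaveSpace n) : Prop :=
  IsDensityOperator ρ ∧
    ∃ (c : ℝ) (d : Fin n ⊕ Fin n → ℝ) (M : Matrix (Fin n ⊕ Fin n) (Fin n ⊕ Fin n) ℝ),
      M.PosDef ∧ ∀ z : PhaseSpace n, wigner ħ ρ z =
        c * Real.exp (-(1 / 2) *
          ((fun i => coord i z - d i) ⬝ᵥ M.mulVec fun i => coord i z - d i))

end WignerCovariance

end

noncomputable section

namespace WignerCovariance

open Filter Topology

/-! ### Square roots and traces -/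

section Sqrt

variable {H : Type*} [NormedAddCommGroup H] [InnerProductSpace ℂ H] [CompleteSpace H]

/-! Everything is read off from the characteristic function of ρ. With φₖ = √ρ eₖ one has W(z) = Σₖ
⟨φₖ, A_z φₖ⟩, and on a vector the Fourier transform of z ↦ ⟨φ, A_z φ⟩ is formally the matrix element
of a Weyl operator. So ∫ W(z) exp(i(a·q + b·p)) dz should be Tr(ρ exp(i(a·q̂ + b·p̂))). Only W
itself is known to be integrable, so `tsum_autocorr_eq_integral` inverts the Fourier transform in
the momentum alone, under an integrable weight in q, and `hasSum_inner_weylOp` removes a Gaussian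
weight.

By the Weyl relations this formula evaluates the Hilbert–Schmidt inner product of any two operators
U_ξ √ρ and U_η √ρ as a phase times the Fourier transform of W at η - ξ. Hence the inner products of
the difference quotients (exp(itẑᵢ) - 1)/(it) √ρ are integrals of W against the scalar difference
quotients, plus a term from the phase. Finite second moments of W allow dominated convergence as t
and s tend to 0 independently, with limit ⟨zᵢzⱼ⟩ - iħΣᵢⱼ/2.

W may be negative, so finiteness of Tr(ρẑᵢ²) cannot come from positivity of W. It comes from the
double limit: expanding ‖a - b‖² shows that the quotients are Cauchy in Hilbert–Schmidt norm. They
then converge strongly on the range of √ρ, and a strong limit of the quotients lies in the graph of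
ẑᵢ on its maximal domain. So ẑᵢ√ρ is everywhere defined and Hilbert–Schmidt, and the limits are its
moments.

After centering, the Gram matrix of the (ẑᵢ - dᵢ)√ρ is γ(W)/2 - iħΣ/2. Its real part is the
covariance identity; twice its transpose is γ(W) + iħΣ, which is therefore positive semidefinite. A
Gaussian W has finite second moments because M is positive definite, and total mass one forces c ≥
0. -/

theorem opSqrt_opSqrt {T : H →L[ℂ] H} (hT : T.IsPositive) (x : H) :
    opSqrt T (opSqrt T x) = T x := by
  have h : opSqrt T * opSqrt T = T :=
    CFC.sqrt_mul_sqrt_self T ((ContinuousLinearMap.nonneg_iff_isPositive T).2 hT)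
  exact congrArg (fun S : H →L[ℂ] H => S x) h

theorem inner_opSqrt_left (T : H →L[ℂ] H) (x y : H) :
    ⟪opSqrt T x, y⟫_ℂ = ⟪x, opSqrt T y⟫_ℂ := by
  have h : (opSqrt T).IsPositive :=
    (ContinuousLinearMap.nonneg_iff_isPositive _).1 (CFC.sqrt_nonneg T)
  exact h.isSymmetric x y

end Sqrt

/-! ### Hilbert–Schmidt operators through their columns in a Hilbert basis. -/

section HilbertSchmidt

variable {ι H : Type*} [NormedAddCommGroup H] [InnerProductSpace ℂ H]

theorem hasSum_norm_inner_sq (e : HilbertBasis ι ℂ H) (x : H) :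
    HasSum (fun k => ‖⟪e k, x⟫_ℂ‖ ^ 2) (‖x‖ ^ 2) := by
  have h := (e.hasSum_inner_mul_inner x x).mapL Complex.reCLM
  simp only [inner_self_eq_norm_sq_to_K] at h
  convert h using 1
  · ext k
    rw [Complex.reCLM_apply, ← inner_conj_symm x (e k), RCLike.conj_mul]
    norm_cast
  · simp only [Complex.reCLM_apply]
    norm_cast

theorem summable_norm_map_sq {φ : ι → H} (hφ : Summable fun k => ‖φ k‖ ^ 2) (A : H →L[ℂ] H) :
    Summable fun k => ‖A (φ k)‖ ^ 2 := by
  refine Summable.of_nonneg_of_le (fun _ => by positivity) (fun k => ?_) (hφ.mul_left (‖A‖ ^ 2))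
  rw [← mul_pow]
  exact pow_le_pow_left₀ (norm_nonneg _) (A.le_opNorm _) 2

/-- The Hilbert--Schmidt norm dominates the operator norm. -/
theorem norm_sq_le_of_hilbertSchmidt (e : HilbertBasis ι ℂ H) (T : H →L[ℂ] H)
    (hT : Summable fun k => ‖T (e k)‖ ^ 2) (x : H) :
    ‖T x‖ ^ 2 ≤ ‖x‖ ^ 2 * ∑' k, ‖T (e k)‖ ^ 2 := by
  have h1 : HasSum (fun k => ⟪e k, x⟫_ℂ • T (e k)) (T x) := by
    have := (e.hasSum_repr x).mapL T
    simpa [e.repr_apply_apply] using this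
  have h2 := hasSum_norm_inner_sq e x
  have h3 : Tendsto (fun s : Finset ι => ‖∑ k ∈ s, ⟪e k, x⟫_ℂ • T (e k)‖ ^ 2) atTop
      (𝓝 (‖T x‖ ^ 2)) := (Tendsto.norm h1).pow 2
  refine le_of_tendsto h3 (.of_forall fun s => ?_)
  calc ‖∑ k ∈ s, ⟪e k, x⟫_ℂ • T (e k)‖ ^ 2
      ≤ (∑ k ∈ s, ‖⟪e k, x⟫_ℂ‖ * ‖T (e k)‖) ^ 2 := by
        gcongr
        refine (norm_sum_le _ _).trans_eq (Finset.sum_congr rfl fun k _ => norm_smul _ _)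
    _ ≤ (∑ k ∈ s, ‖⟪e k, x⟫_ℂ‖ ^ 2) * ∑ k ∈ s, ‖T (e k)‖ ^ 2 :=
        Finset.sum_mul_sq_le_sq_mul_sq _ _ _
    _ ≤ _ := by
        gcongr
        · exact sum_le_hasSum s (fun _ _ => by positivity) h2
        · exact hT.sum_le_tsum s (fun _ _ => by positivity)

/-- Cyclicity of the trace for products of Hilbert--Schmidt operators. -/
theorem tsum_inner_map_map [CompleteSpace H] (e : HilbertBasis ι ℂ H) (S T : H →L[ℂ] H)
    (hS : Summable fun k => ‖S (e k)‖ ^ 2)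
    (hT : Summable fun k => ‖T.adjoint (e k)‖ ^ 2) :
    ∑' k, ⟪S (e k), T (e k)⟫_ℂ = ∑' l, ⟪T.adjoint (e l), S.adjoint (e l)⟫_ℂ := by
  -- Parseval applied to the columns of S and of T† makes both factors square summable over pairs,
  -- so the product is absolutely summable and the two sums may be exchanged.
  have key : Summable fun u : ι × ι => ⟪S (e u.1), e u.2⟫_ℂ * ⟪e u.2, T (e u.1)⟫_ℂ := by
    have hA : Summable fun u : ι × ι => ‖⟪S (e u.1), e u.2⟫_ℂ‖ ^ 2 := by
      refine (summable_prod_of_nonneg fun _ => by positivity).2 ⟨fun k => ?_, ?_⟩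
      · simpa only [norm_inner_symm] using (hasSum_norm_inner_sq e (S (e k))).summable
      · refine hS.congr fun k => ?_
        simpa only [norm_inner_symm] using (hasSum_norm_inner_sq e (S (e k))).tsum_eq.symm
    have hB : Summable fun u : ι × ι => ‖⟪e u.2, T (e u.1)⟫_ℂ‖ ^ 2 := by
      rw [← (Equiv.prodComm ι ι).summable_iff]
      refine (summable_prod_of_nonneg fun _ => sq_nonneg _).2 ⟨fun k => ?_, ?_⟩
      · refine (hasSum_norm_inner_sq e (T.adjoint (e k))).summable.congr fun l => ?_
        simp [ContinuousLinearMap.adjoint_inner_right, norm_inner_symm]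
      · refine hT.congr fun k => ?_
        rw [← (hasSum_norm_inner_sq e (T.adjoint (e k))).tsum_eq]
        refine tsum_congr fun l => ?_
        simp [ContinuousLinearMap.adjoint_inner_right, norm_inner_symm]
    refine Summable.of_norm_bounded (hA.add hB) fun u => ?_
    rw [norm_mul]
    nlinarith [sq_nonneg (‖⟪S (e u.1), e u.2⟫_ℂ‖ - ‖⟪e u.2, T (e u.1)⟫_ℂ‖),
      sq_nonneg ‖⟪S (e u.1), e u.2⟫_ℂ‖, sq_nonneg ‖⟪e u.2, T (e u.1)⟫_ℂ‖]
  have h1 : ∀ k, ⟪S (e k), T (e k)⟫_ℂ = ∑' l, ⟪S (e k), e l⟫_ℂ * ⟪e l, T (e k)⟫_ℂ :=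
    fun k => (e.tsum_inner_mul_inner _ _).symm
  have h2 : ∀ l, ⟪T.adjoint (e l), S.adjoint (e l)⟫_ℂ =
      ∑' k, ⟪S (e k), e l⟫_ℂ * ⟪e l, T (e k)⟫_ℂ := fun l => by
    rw [← e.tsum_inner_mul_inner]
    refine tsum_congr fun k => ?_
    rw [ContinuousLinearMap.adjoint_inner_left, ContinuousLinearMap.adjoint_inner_right, mul_comm]
  simp_rw [h1, h2]
  exact (Summable.tsum_comm (f := fun k l => ⟪S (e k), e l⟫_ℂ * ⟪e l, T (e k)⟫_ℂ) key).symm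

end HilbertSchmidt

/-! ### Traces against ρ as sums over the columns of √ρ. -/

section Columns

variable {n : ℕ} {ρ : WaveSpace n →L[ℂ] WaveSpace n}

/-- Since ⟨eₖ, ρ eₖ⟩ = ‖√ρ eₖ‖², trace one means that √ρ has Hilbert–Schmidt norm one. This is the
summable majorant for the sums over columns below. -/
theorem hasSum_norm_sqrtCol_sq (hρ : IsDensityOperator ρ) :
    HasSum (fun k => ‖sqrtCol ρ k‖ ^ 2) 1 := by
  have h := hρ.2.mapL Complex.reCLM
  rw [Complex.reCLM_apply, Complex.one_re] at h
  convert h using 1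
  ext k
  rw [Complex.reCLM_apply, ← opSqrt_opSqrt hρ.1, ← inner_opSqrt_left,
    inner_self_eq_norm_sq_to_K]
  norm_cast

theorem summable_inner_sqrtCol (hρ : IsDensityOperator ρ) (A : WaveSpace n →L[ℂ] WaveSpace n) :
    Summable fun k => ‖⟪sqrtCol ρ k, A (sqrtCol ρ k)⟫_ℂ‖ := by
  refine Summable.of_nonneg_of_le (fun _ => norm_nonneg _) (fun k => ?_)
    ((hasSum_norm_sqrtCol_sq hρ).summable.mul_left ‖A‖)
  calc _ ≤ ‖sqrtCol ρ k‖ * ‖A (sqrtCol ρ k)‖ := norm_inner_le_norm _ _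
    _ ≤ ‖sqrtCol ρ k‖ * (‖A‖ * ‖sqrtCol ρ k‖) := by gcongr; exact A.le_opNorm _
    _ = _ := by ring

/-- `Tr(ρ A) = Tr(√ρ A √ρ)` for bounded `A`. -/
theorem opTrace_comp (hρ : IsDensityOperator ρ) (A : WaveSpace n →L[ℂ] WaveSpace n) :
    opTrace (ρ ∘L A) = ∑' k, ⟪sqrtCol ρ k, A (sqrtCol ρ k)⟫_ℂ := by
  have hs : (opSqrt ρ).adjoint = opSqrt ρ := by
    refine (ContinuousLinearMap.eq_adjoint_iff _ _).2 (inner_opSqrt_left ρ) |>.symm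
  have h0 := (hasSum_norm_sqrtCol_sq hρ).summable
  -- Cyclicity with S = √ρ and T = √ρ A moves one factor √ρ to the other side of A.
  have h := tsum_inner_map_map (waveBasis n) (opSqrt ρ) (opSqrt ρ ∘L A) h0 (by
    refine (summable_norm_map_sq h0 A.adjoint).congr fun k => ?_
    rw [ContinuousLinearMap.adjoint_comp, hs]
    rfl)
  rw [ContinuousLinearMap.adjoint_comp, hs] at h
  rw [opTrace]
  convert h using 2 with k
  · ext k
    rw [ContinuousLinearMap.comp_apply, ContinuousLinearMap.comp_apply, inner_opSqrt_left,
      opSqrt_opSqrt hρ.1]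
  · ext k
    rw [ContinuousLinearMap.comp_apply, ContinuousLinearMap.adjoint_inner_left]
    rfl

/-- Phase point operators are symmetric. -/
theorem inner_phasePointOp_symm (ħ : ℝ) (z : PhaseSpace n) (φ ψ : WaveSpace n) :
    conj ⟪φ, phasePointOp ħ z ψ⟫_ℂ = ⟪ψ, phasePointOp ħ z φ⟫_ℂ := by
  -- The reflection y ↦ -y undoes the effect of conjugation on the phase and swaps the two arguments
  -- q ± y/2.
  rw [inner_phasePointOp, inner_phasePointOp, map_mul, Complex.conj_ofReal, ← integral_conj,
    ← integral_neg_eq_self]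
  congr 2
  ext y
  simp only [map_mul, ← Complex.exp_conj, map_neg, Complex.conj_I, Complex.conj_ofReal,
    Complex.conj_conj, inner_neg_right, smul_neg, sub_neg_eq_add, ← sub_eq_add_neg, neg_div]
  push_cast
  ring_nf

/-- The Wigner function as a sum over the columns of `√ρ`. -/
theorem hasSum_wigner (hρ : IsDensityOperator ρ) (ħ : ℝ) (z : PhaseSpace n) :
    HasSum (fun k => ⟪sqrtCol ρ k, phasePointOp ħ z (sqrtCol ρ k)⟫_ℂ) (wigner ħ ρ z : ℂ) := by
  have hs := (summable_inner_sqrtCol hρ (phasePointOp ħ z)).of_norm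
  have h : (wigner ħ ρ z : ℂ) = ∑' k, ⟪sqrtCol ρ k, phasePointOp ħ z (sqrtCol ρ k)⟫_ℂ := by
    unfold wigner
    rw [opTrace_comp hρ, ← Complex.conj_eq_iff_re, Complex.conj_tsum]
    exact tsum_congr fun k => inner_phasePointOp_symm ħ z _ _
  rw [h]
  exact hs.hasSum

end Columns

/-! ### Multiplication, translation and Weyl operators -/

section Operators

variable {n : ℕ}

theorem memLp_mul_wave {w : Config n → ℂ} (hw : Continuous w) (hb : ∀ x, ‖w x‖ ≤ 1)
    (ψ : WaveSpace n) : MemLp (fun x => w x * ψ x) 2 (volume : Measure (Config n)) := by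
  refine (Lp.memLp ψ).of_le (hw.aestronglyMeasurable.mul (Lp.aestronglyMeasurable ψ))
    (.of_forall fun x => ?_)
  rw [norm_mul]
  exact mul_le_of_le_one_left (norm_nonneg _) (hb x)

/-- Multiplication by a continuous function bounded by one. -/
def mulOp (w : Config n → ℂ) (hw : Continuous w) (hb : ∀ x, ‖w x‖ ≤ 1) :
    WaveSpace n →L[ℂ] WaveSpace n :=
  LinearMap.mkContinuous
    { toFun := fun ψ => (memLp_mul_wave hw hb ψ).toLp _
      map_add' := fun ψ φ => by
        rw [← MemLp.toLp_add, MemLp.toLp_eq_toLp_iff]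
        filter_upwards [Lp.coeFn_add ψ φ] with x hx
        simp only [hx, Pi.add_apply, mul_add]
      map_smul' := fun c ψ => by
        rw [RingHom.id_apply, ← MemLp.toLp_const_smul, MemLp.toLp_eq_toLp_iff]
        filter_upwards [Lp.coeFn_smul c ψ] with x hx
        simp only [hx, Pi.smul_apply, smul_eq_mul]
        ring }
    1
    (fun ψ => by
      refine Lp.norm_le_mul_norm_of_ae_le_mul ?_
      filter_upwards [MemLp.coeFn_toLp (memLp_mul_wave hw hb ψ)] with x h1
      refine (congrArg norm h1).trans_le ?_
      rw [norm_mul]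
      gcongr
      exact hb x)

theorem coeFn_mulOp {w : Config n → ℂ} (hw : Continuous w) (hb : ∀ x, ‖w x‖ ≤ 1)
    (ψ : WaveSpace n) : mulOp w hw hb ψ =ᵐ[volume] fun x => w x * ψ x :=
  MemLp.coeFn_toLp (memLp_mul_wave hw hb ψ)

theorem norm_mulOp_le {w : Config n → ℂ} (hw : Continuous w) (hb : ∀ x, ‖w x‖ ≤ 1)
    (ψ : WaveSpace n) : ‖mulOp w hw hb ψ‖ ≤ ‖ψ‖ := by
  have h := (mulOp w hw hb).le_of_opNorm_le (LinearMap.mkContinuous_norm_le _ zero_le_one _) ψ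
  rwa [one_mul] at h

/-- Translation: `(translate v ψ)(x) = ψ(x + v)`. -/
def translate (v : Config n) : WaveSpace n →ₗᵢ[ℂ] WaveSpace n :=
  Lp.compMeasurePreservingₗᵢ ℂ (· + v) (measurePreserving_add_right volume v)

theorem coeFn_translate (v : Config n) (ψ : WaveSpace n) :
    translate v ψ =ᵐ[volume] fun x => ψ (x + v) :=
  Lp.coeFn_compMeasurePreserving ψ (measurePreserving_add_right volume v)

theorem continuous_translate (ψ : WaveSpace n) : Continuous fun v => translate v ψ := by
  have hg : Continuous fun v : Config n => (⟨(· + v), by fun_prop⟩ : C(Config n, Config n)) :=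
    ContinuousMap.continuous_of_continuous_uncurry _ (by
      simp only [Function.uncurry_def, ContinuousMap.coe_mk]; fun_prop)
  exact Continuous.compMeasurePreservingLp (continuous_const (y := ψ)) hg
    (fun v => measurePreserving_add_right volume v) (by simp)

/-- The weighted autocorrelation `∫ dq w(q) conj(φ(q - y/2)) φ(q + y/2)`. -/
def autocorr (w : Config n → ℂ) (φ : WaveSpace n) (y : Config n) : ℂ :=
  ∫ q, w q * (conj (φ (q - (1 / 2 : ℝ) • y)) * φ (q + (1 / 2 : ℝ) • y))

/-- As an inner product of two translates of φ, the autocorrelation inherits a bound from unitarity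
and continuity in y from strong continuity of translations. Neither needs w to be integrable. -/
theorem autocorr_eq_inner {w : Config n → ℂ} (hw : Continuous w) (hb : ∀ x, ‖w x‖ ≤ 1)
    (φ : WaveSpace n) (y : Config n) : autocorr w φ y =
      ⟪translate (-((1 / 2 : ℝ) • y)) φ, mulOp w hw hb (translate ((1 / 2 : ℝ) • y) φ)⟫_ℂ := by
  rw [L2.inner_def, autocorr]
  refine integral_congr_ae ?_
  filter_upwards [coeFn_mulOp hw hb (translate ((1 / 2 : ℝ) • y) φ),
    coeFn_translate ((1 / 2 : ℝ) • y) φ, coeFn_translate (-((1 / 2 : ℝ) • y)) φ] with x h1 h2 h3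
  rw [RCLike.inner_apply, h1, h2, h3, sub_eq_add_neg]
  ring

theorem norm_autocorr_le {w : Config n → ℂ} (hw : Continuous w) (hb : ∀ x, ‖w x‖ ≤ 1)
    (φ : WaveSpace n) (y : Config n) : ‖autocorr w φ y‖ ≤ ‖φ‖ ^ 2 := by
  rw [autocorr_eq_inner hw hb]
  refine (norm_inner_le_norm _ _).trans ?_
  have h := norm_mulOp_le hw hb (translate ((1 / 2 : ℝ) • y) φ)
  rw [LinearIsometry.norm_map] at h ⊢
  rw [pow_two]
  gcongr

theorem continuous_autocorr {w : Config n → ℂ} (hw : Continuous w) (hb : ∀ x, ‖w x‖ ≤ 1)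
    (φ : WaveSpace n) : Continuous (autocorr w φ) := by
  rw [funext (autocorr_eq_inner hw hb φ)]
  have h1 : Continuous fun y : Config n => translate (-((1 / 2 : ℝ) • y)) φ :=
    (continuous_translate φ).comp (by fun_prop)
  have h2 : Continuous fun y : Config n => translate ((1 / 2 : ℝ) • y) φ :=
    (continuous_translate φ).comp (by fun_prop)
  exact h1.inner ((mulOp w hw hb).continuous.comp h2)

/-- The pairing `a·q + b·p` of phase space with itself. -/
def pairing (ξ z : PhaseSpace n) : ℝ := ⟪ξ.1, z.1⟫_ℝ + ⟪ξ.2, z.2⟫_ℝ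

/-- The symplectic form `a·b' - a'·b`. -/
def symplectic (ξ η : PhaseSpace n) : ℝ := ⟪ξ.1, η.2⟫_ℝ - ⟪η.1, ξ.2⟫_ℝ

theorem norm_exp_I_mul_ofReal (x : ℝ) : ‖Complex.exp (Complex.I * (x : ℂ))‖ = 1 := by
  rw [mul_comm, Complex.norm_exp_ofReal_mul_I]

/-- The Weyl operator `exp(i(a·q̂ + b·p̂))`, that is
`ψ ↦ exp(i a·(x + ħb/2)) ψ(x + ħb)`. -/
def weylOp (ħ : ℝ) (ξ : PhaseSpace n) : WaveSpace n →L[ℂ] WaveSpace n :=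
  mulOp (fun x => Complex.exp (Complex.I * ((⟪ξ.1, x + (ħ / 2) • ξ.2⟫_ℝ : ℝ) : ℂ)))
    (by fun_prop) (fun _ => (norm_exp_I_mul_ofReal _).le) ∘L
    (translate (ħ • ξ.2)).toContinuousLinearMap

theorem coeFn_weylOp (ħ : ℝ) (ξ : PhaseSpace n) (ψ : WaveSpace n) :
    weylOp ħ ξ ψ =ᵐ[volume] fun x =>
      Complex.exp (Complex.I * ((⟪ξ.1, x + (ħ / 2) • ξ.2⟫_ℝ : ℝ) : ℂ)) * ψ (x + ħ • ξ.2) := by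
  refine (coeFn_mulOp (by fun_prop) (fun _ => (norm_exp_I_mul_ofReal _).le) _).trans ?_
  filter_upwards [coeFn_translate (ħ • ξ.2) ψ] with x hx
  congr 1

theorem weylOp_zero (ħ : ℝ) (ψ : WaveSpace n) : weylOp ħ 0 ψ = ψ := by
  refine Lp.ext ((coeFn_weylOp ħ 0 ψ).trans (.of_forall fun x => ?_))
  simp

theorem inner_weylOp (ħ : ℝ) (ξ : PhaseSpace n) (φ ψ : WaveSpace n) :
    ⟪φ, weylOp ħ ξ ψ⟫_ℂ = ∫ x, conj (φ x) *
      (Complex.exp (Complex.I * ((⟪ξ.1, x + (ħ / 2) • ξ.2⟫_ℝ : ℝ) : ℂ)) * ψ (x + ħ • ξ.2)) := by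
  rw [L2.inner_def]
  refine integral_congr_ae ?_
  filter_upwards [coeFn_weylOp ħ ξ ψ] with x hx
  rw [RCLike.inner_apply, hx, mul_comm]

/-- The Weyl form of the canonical commutation relations. -/
theorem inner_weylOp_weylOp (ħ : ℝ) (ξ η : PhaseSpace n) (φ ψ : WaveSpace n) :
    ⟪weylOp ħ ξ φ, weylOp ħ η ψ⟫_ℂ =
      Complex.exp (Complex.I * ((ħ / 2 * symplectic ξ η : ℝ) : ℂ)) *
        ⟪φ, weylOp ħ (η - ξ) ψ⟫_ℂ := by
  have h1 : ⟪weylOp ħ ξ φ, weylOp ħ η ψ⟫_ℂ = ∫ x,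
      conj (Complex.exp (Complex.I * ((⟪ξ.1, x + (ħ / 2) • ξ.2⟫_ℝ : ℝ) : ℂ)) * φ (x + ħ • ξ.2)) *
      (Complex.exp (Complex.I * ((⟪η.1, x + (ħ / 2) • η.2⟫_ℝ : ℝ) : ℂ)) * ψ (x + ħ • η.2)) := by
    rw [inner_weylOp]
    refine integral_congr_ae ?_
    filter_upwards [coeFn_weylOp ħ ξ φ] with x hx
    rw [hx]
  -- Shifting x by ħξ₂ removes the displacement from φ; what remains is to compare the exponents,
  -- and their constant part is the symplectic phase.
  rw [h1, inner_weylOp, ← integral_const_mul, ← integral_sub_right_eq_self _ (ħ • ξ.2)]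
  refine integral_congr_ae (.of_forall fun x => ?_)
  have e1 : x - ħ • ξ.2 + ħ • ξ.2 = x := by abel
  have e2 : x - ħ • ξ.2 + ħ • η.2 = x + ħ • (η - ξ).2 := by
    rw [Prod.snd_sub, smul_sub]; abel
  simp only [e1, e2, map_mul, ← Complex.exp_conj, Complex.conj_I, Complex.conj_ofReal]
  have e3 : Complex.exp (-Complex.I * ((⟪ξ.1, x - ħ • ξ.2 + (ħ / 2) • ξ.2⟫_ℝ : ℝ) : ℂ)) *
      Complex.exp (Complex.I * ((⟪η.1, x - ħ • ξ.2 + (ħ / 2) • η.2⟫_ℝ : ℝ) : ℂ)) =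
      Complex.exp (Complex.I * ((ħ / 2 * symplectic ξ η : ℝ) : ℂ)) *
      Complex.exp (Complex.I * ((⟪(η - ξ).1, x + (ħ / 2) • (η - ξ).2⟫_ℝ : ℝ) : ℂ)) := by
    rw [← Complex.exp_add, ← Complex.exp_add, neg_mul, ← mul_neg, ← mul_add, ← mul_add]
    congr 2
    norm_cast
    simp only [symplectic, Prod.fst_sub, Prod.snd_sub, inner_add_right, inner_sub_right,
      inner_sub_left, inner_smul_right]
    ring
  rw [mul_mul_mul_comm, e3]
  ring

/-- Diagonal matrix elements of Weyl operators. -/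
theorem inner_weylOp_self (ħ : ℝ) (ξ : PhaseSpace n) (φ : WaveSpace n) :
    ⟪φ, weylOp ħ ξ φ⟫_ℂ =
      autocorr (fun q => Complex.exp (Complex.I * ((⟪ξ.1, q⟫_ℝ : ℝ) : ℂ))) φ (ħ • ξ.2) := by
  rw [inner_weylOp, autocorr, ← integral_sub_right_eq_self _ ((1 / 2 : ℝ) • ħ • ξ.2)]
  refine integral_congr_ae (.of_forall fun x => ?_)
  have e1 : x - (1 / 2 : ℝ) • ħ • ξ.2 + (ħ / 2) • ξ.2 = x := by
    rw [smul_smul, one_div_mul_eq_div]; abel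
  have e2 : x - (1 / 2 : ℝ) • ħ • ξ.2 + ħ • ξ.2 = x + (1 / 2 : ℝ) • ħ • ξ.2 := by module
  simp only [e1, e2]
  ring

end Operators

/-! ### The Fourier transform of the Wigner function -/

section Fourier

variable {n : ℕ}

/-- Orthonormal vectors are √2 apart, so the balls of radius 1/2 around them are disjoint, and a
separable space holds only countably many. The exponent 2 ≠ ⊤ gives separability. Countability is
what allows sums over k to be exchanged with integrals. -/
instance countable_basisIndex (n : ℕ) : Countable (basisIndex n) := by
  have : Fact ((2 : ENNReal) ≠ ⊤) := ⟨by simp⟩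
  have hd : Pairwise (Function.onFun Disjoint fun k : basisIndex n =>
      Metric.ball (waveBasis n k) (1 / 2)) := by
    intro k l hkl
    refine Metric.ball_disjoint_ball ?_
    have h := (waveBasis n).orthonormal
    have h2 : ‖waveBasis n k - waveBasis n l‖ ^ 2 = 2 := by
      rw [@norm_sub_sq ℂ, h.2 hkl, h.1, h.1]
      norm_num
    rw [dist_eq_norm]
    nlinarith [norm_nonneg (waveBasis n k - waveBasis n l)]
  exact hd.countable_of_isOpen_disjoint (fun _ => Metric.isOpen_ball)
    fun k => ⟨waveBasis n k, Metric.mem_ball_self (by norm_num)⟩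

theorem integrable_tsum_of_summable_integral_norm {α ι : Type*} [MeasurableSpace α] [Countable ι]
    {μ : Measure α} {F : ι → α → ℂ} (hF : ∀ i, Integrable (F i) μ)
    (hs : Summable fun i => ∫ a, ‖F i a‖ ∂μ)
    (hm : AEStronglyMeasurable (fun a => ∑' i, F i a) μ) :
    Integrable (fun a => ∑' i, F i a) μ := by
  refine ⟨hm, ?_⟩
  have h1 : ∀ i, ∫⁻ a, ‖F i a‖ₑ ∂μ = ENNReal.ofReal (∫ a, ‖F i a‖ ∂μ) := fun i =>
    (ofReal_integral_norm_eq_lintegral_enorm (hF i)).symm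
  calc ∫⁻ a, ‖∑' i, F i a‖ₑ ∂μ ≤ ∫⁻ a, ∑' i, ‖F i a‖ₑ ∂μ :=
        lintegral_mono fun a => enorm_tsum_le_tsum_enorm
    _ = ∑' i, ∫⁻ a, ‖F i a‖ₑ ∂μ := lintegral_tsum fun i => (hF i).1.enorm
    _ = ENNReal.ofReal (∑' i, ∫ a, ‖F i a‖ ∂μ) := by
        simp_rw [h1]
        rw [ENNReal.ofReal_tsum_of_nonneg (fun i => integral_nonneg fun a => norm_nonneg _) hs]
    _ < ⊤ := ENNReal.ofReal_lt_top

theorem integrable_norm_wave_sq (φ : WaveSpace n) : Integrable fun x => ‖φ x‖ ^ 2 :=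
  (memLp_two_iff_integrable_sq_norm (Lp.aestronglyMeasurable φ)).1 (Lp.memLp φ)

theorem integral_norm_wave_sq (φ : WaveSpace n) : ∫ x, ‖φ x‖ ^ 2 = ‖φ‖ ^ 2 := by
  have h := L2.inner_def (𝕜 := ℂ) φ φ
  simp only [inner_self_eq_norm_sq_to_K] at h
  norm_cast at h
  exact h.symm

theorem integrable_norm_wave_sq_affine (φ : WaveSpace n) (q : Config n) {c : ℝ} (hc : c ≠ 0) :
    Integrable fun y => ‖φ (q + c • y)‖ ^ 2 :=
  ((integrable_norm_wave_sq φ).comp_add_left q).comp_smul hc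

theorem integral_norm_wave_sq_affine (φ : WaveSpace n) (q : Config n) (c : ℝ) :
    ∫ y, ‖φ (q + c • y)‖ ^ 2 = |(c ^ n)⁻¹| * ‖φ‖ ^ 2 := by
  rw [Measure.integral_comp_smul volume (fun y => ‖φ (q + y)‖ ^ 2) c,
    integral_add_left_eq_self (fun y => ‖φ y‖ ^ 2) q, integral_norm_wave_sq,
    finrank_euclideanSpace_fin, smul_eq_mul]

/-- The kernel `conj(φ(q - y/2)) φ(q + y/2)`. -/
def wignerDensity (φ : WaveSpace n) (q y : Config n) : ℂ :=
  conj (φ (q - (1 / 2 : ℝ) • y)) * φ (q + (1 / 2 : ℝ) • y)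

theorem norm_wignerDensity_le (φ : WaveSpace n) (q y : Config n) : ‖wignerDensity φ q y‖ ≤
    (‖φ (q + (-(1 / 2) : ℝ) • y)‖ ^ 2 + ‖φ (q + (1 / 2 : ℝ) • y)‖ ^ 2) / 2 := by
  rw [wignerDensity, norm_mul, RCLike.norm_conj, neg_smul, ← sub_eq_add_neg]
  nlinarith [sq_nonneg (‖φ (q - (1 / 2 : ℝ) • y)‖ - ‖φ (q + (1 / 2 : ℝ) • y)‖)]

theorem stronglyMeasurable_wignerDensity (φ : WaveSpace n) :
    StronglyMeasurable fun u : Config n × Config n => wignerDensity φ u.1 u.2 := by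
  have h := Lp.stronglyMeasurable φ
  have h1 : StronglyMeasurable fun u : Config n × Config n => φ (u.1 - (1 / 2 : ℝ) • u.2) :=
    h.comp_measurable (by fun_prop)
  have h2 : StronglyMeasurable fun u : Config n × Config n => φ (u.1 + (1 / 2 : ℝ) • u.2) :=
    h.comp_measurable (by fun_prop)
  exact (Complex.continuous_conj.comp_stronglyMeasurable h1).mul h2

theorem integrable_wignerDensity (φ : WaveSpace n) (q : Config n) :
    Integrable (wignerDensity φ q) :=
  (((integrable_norm_wave_sq_affine φ q (by norm_num)).add
    (integrable_norm_wave_sq_affine φ q (by norm_num))).div_const 2).mono'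
    ((stronglyMeasurable_wignerDensity φ).comp_measurable
      (measurable_const.prodMk measurable_id)).aestronglyMeasurable
    (.of_forall (norm_wignerDensity_le φ q))

/-- The bound is uniform in q, so an integrable weight in q suffices for joint integrability. The
factor 2ⁿ is the Jacobian of y ↦ y/2. -/
theorem integral_norm_wignerDensity_le (φ : WaveSpace n) (q : Config n) :
    ∫ y, ‖wignerDensity φ q y‖ ≤ 2 ^ n * ‖φ‖ ^ 2 := by
  have h1 := integrable_norm_wave_sq_affine φ q (c := -(1 / 2)) (by norm_num)
  have h2 := integrable_norm_wave_sq_affine φ q (c := 1 / 2) (by norm_num)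
  refine (integral_mono (integrable_wignerDensity φ q).norm ((h1.add h2).div_const 2)
    (norm_wignerDensity_le φ q)).trans_eq ?_
  rw [integral_div, integral_add' h1 h2, integral_norm_wave_sq_affine,
    integral_norm_wave_sq_affine, abs_inv, abs_inv, abs_pow, abs_pow, abs_neg,
    abs_of_pos (by norm_num : (0 : ℝ) < 1 / 2), one_div, inv_pow, inv_inv]
  ring

theorem integrable_wignerDensity_left (φ : WaveSpace n) (y : Config n) :
    Integrable fun q => wignerDensity φ q y := by
  have h1 : MemLp (fun q => φ (q - (1 / 2 : ℝ) • y)) 2 (volume : Measure (Config n)) :=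
    (Lp.memLp φ).comp_measurePreserving (measurePreserving_sub_right volume _)
  have h2 : MemLp (fun q => φ (q + (1 / 2 : ℝ) • y)) 2 (volume : Measure (Config n)) :=
    (Lp.memLp φ).comp_measurePreserving (measurePreserving_add_right volume _)
  exact h1.star.integrable_mul h2

/-! ### Fourier inversion under an integrable position weight. -/

variable {w : Config n → ℂ}

/-- For φ merely in L² the unweighted density need not be jointly integrable in (q, y); the weight
makes Fubini available. -/
theorem integrable_mul_wignerDensity (hw : Integrable w) (φ : WaveSpace n) :
    Integrable (fun u : Config n × Config n => w u.1 * wignerDensity φ u.1 u.2)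
      (volume.prod volume) := by
  have hm : AEStronglyMeasurable (fun u : Config n × Config n => w u.1 * wignerDensity φ u.1 u.2)
      (volume.prod volume) :=
    (hw.1.comp_fst).mul (stronglyMeasurable_wignerDensity φ).aestronglyMeasurable
  refine (integrable_prod_iff hm).2 ⟨.of_forall fun q => ?_, ?_⟩
  · exact (integrable_wignerDensity φ q).const_mul (w q)
  · refine (hw.norm.mul_const (2 ^ n * ‖φ‖ ^ 2)).mono' hm.norm.integral_prod_right'
      (.of_forall fun q => ?_)
    simp only [norm_mul, integral_const_mul]
    rw [norm_norm, Real.norm_of_nonneg (integral_nonneg fun _ => norm_nonneg _)]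
    gcongr
    exact integral_norm_wignerDensity_le φ q

theorem autocorr_eq_integral_wignerDensity (w : Config n → ℂ) (φ : WaveSpace n) (y : Config n) :
    autocorr w φ y = ∫ q, w q * wignerDensity φ q y := rfl

theorem integrable_autocorr (hw : Integrable w) (φ : WaveSpace n) : Integrable (autocorr w φ) :=
  (integrable_mul_wignerDensity hw φ).integral_prod_right

theorem integral_norm_autocorr_le (hw : Integrable w) (φ : WaveSpace n) :
    ∫ y, ‖autocorr w φ y‖ ≤ (∫ q, ‖w q‖) * 2 ^ n * ‖φ‖ ^ 2 := by
  have hK := (integrable_mul_wignerDensity hw φ).norm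
  calc ∫ y, ‖autocorr w φ y‖ ≤ ∫ y, ∫ q, ‖w q * wignerDensity φ q y‖ :=
        integral_mono (integrable_autocorr hw φ).norm hK.integral_prod_right
          fun y => norm_integral_le_integral_norm _
    _ = ∫ q, ∫ y, ‖w q * wignerDensity φ q y‖ := (integral_integral_swap hK).symm
    _ ≤ ∫ q, ‖w q‖ * (2 ^ n * ‖φ‖ ^ 2) := by
        refine integral_mono hK.integral_prod_left (hw.norm.mul_const _) fun q => ?_
        simp only [norm_mul, integral_const_mul]
        gcongr
        exact integral_norm_wignerDensity_le φ q
    _ = _ := by rw [integral_mul_const]; ring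

theorem norm_inner_phasePointOp_le (ħ : ℝ) (z : PhaseSpace n) (φ : WaveSpace n) :
    ‖⟪φ, phasePointOp ħ z φ⟫_ℂ‖ ≤ |((Real.pi * ħ) ^ n)⁻¹| * ‖φ‖ ^ 2 := by
  have h := (phasePointOp ħ z).le_of_opNorm_le
    (LinearMap.mkContinuous_norm_le _ (abs_nonneg _) _) φ
  calc _ ≤ ‖φ‖ * ‖phasePointOp ħ z φ‖ := norm_inner_le_norm _ _
    _ ≤ ‖φ‖ * (|((Real.pi * ħ) ^ n)⁻¹| * ‖φ‖) := by gcongr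
    _ = _ := by ring

/-- The Wigner function of a vector is the Fourier transform of its autocorrelation. -/
theorem integral_exp_mul_autocorr {ħ : ℝ} (hħ : 0 < ħ) (hw : Integrable w) (φ : WaveSpace n)
    (p : Config n) :
    ∫ y, Complex.exp (-(Complex.I * ((⟪p, y⟫_ℝ / ħ : ℝ) : ℂ))) * autocorr w φ y =
      ((2 * Real.pi * ħ) ^ n : ℝ) * ∫ q, w q * ⟪φ, phasePointOp ħ (q, p) φ⟫_ℂ := by
  have hb : ∀ y : Config n, ‖Complex.exp (-(Complex.I * ((⟪p, y⟫_ℝ / ħ : ℝ) : ℂ)))‖ = 1 := by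
    intro y
    rw [← mul_neg, ← Complex.ofReal_neg, norm_exp_I_mul_ofReal]
  have hK : Integrable (fun u : Config n × Config n =>
      Complex.exp (-(Complex.I * ((⟪p, u.2⟫_ℝ / ħ : ℝ) : ℂ))) *
        (w u.1 * wignerDensity φ u.1 u.2)) (volume.prod volume) := by
    refine (integrable_mul_wignerDensity hw φ).bdd_mul (c := 1)
      (Continuous.aestronglyMeasurable (by fun_prop)) (.of_forall fun u => (hb _).le)
  simp only [autocorr_eq_integral_wignerDensity, ← integral_const_mul]
  rw [← integral_integral_swap hK]
  refine integral_congr_ae (.of_forall fun q => ?_)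
  simp only [inner_phasePointOp]
  rw [mul_left_comm, ← mul_assoc ((_ : ℝ) : ℂ), ← Complex.ofReal_mul,
    mul_inv_cancel₀ (by positivity), Complex.ofReal_one, one_mul, ← integral_const_mul]
  refine integral_congr_ae (.of_forall fun y => ?_)
  simp only [wignerDensity]
  ring

theorem integrable_mul_inner_phasePointOp {ħ : ℝ} (hw : Integrable w)
    (φ : WaveSpace n) (p : Config n) :
    Integrable fun q => w q * ⟪φ, phasePointOp ħ (q, p) φ⟫_ℂ := by
  have hm : StronglyMeasurable fun q : Config n => ⟪φ, phasePointOp ħ (q, p) φ⟫_ℂ := by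
    simp only [inner_phasePointOp]
    refine StronglyMeasurable.const_mul (StronglyMeasurable.integral_prod_right
      (f := fun q y : Config n => Complex.exp (-(Complex.I * ((⟪p, y⟫_ℝ / ħ : ℝ) : ℂ))) *
        wignerDensity φ q y) ?_) _
    exact StronglyMeasurable.mul (Continuous.stronglyMeasurable (by fun_prop))
      (stronglyMeasurable_wignerDensity φ)
  exact hw.mul_bdd hm.aestronglyMeasurable (.of_forall fun q => norm_inner_phasePointOp_le ħ _ φ)

/-- Fourier inversion for the Wigner function, with an integrable weight in the position. -/
theorem tsum_autocorr_eq_integral {ι : Type*} [Countable ι] {ħ : ℝ} (hħ : 0 < ħ)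
    {φ : ι → WaveSpace n} (hφ : Summable fun k => ‖φ k‖ ^ 2) {W : PhaseSpace n → ℂ}
    (hW : ∀ z, HasSum (fun k => ⟪φ k, phasePointOp ħ z (φ k)⟫_ℂ) (W z)) (hWi : Integrable W)
    (hwc : Continuous w) (hwb : ∀ x, ‖w x‖ ≤ 1) (hw : Integrable w) (b : Config n) :
    ∑' k, autocorr w (φ k) (ħ • b) =
      ∫ z : PhaseSpace n, W z * (w z.1 * Complex.exp (Complex.I * ((⟪b, z.2⟫_ℝ : ℝ) : ℂ))) := by
  set h : Config n → ℂ := fun y => ∑' k, autocorr w (φ k) y with hdef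
  -- Continuity lets Fourier inversion hold at every point, in particular at the prescribed y = ħb.
  have hcont : Continuous h := continuous_tsum (fun k => continuous_autocorr hwc hwb (φ k)) hφ
    fun k y => norm_autocorr_le hwc hwb (φ k) y
  have hsum : Summable fun k => ∫ y, ‖autocorr w (φ k) y‖ :=
    Summable.of_nonneg_of_le (fun k => integral_nonneg fun _ => norm_nonneg _)
      (fun k => integral_norm_autocorr_le hw (φ k)) (hφ.mul_left _)
  have hint : Integrable h := integrable_tsum_of_summable_integral_norm
    (fun k => integrable_autocorr hw (φ k)) hsum hcont.aestronglyMeasurable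
  have hwW : Integrable (fun z : PhaseSpace n => w z.1 * W z) :=
    hWi.bdd_mul (c := 1) (hwc.comp continuous_fst).aestronglyMeasurable
      (.of_forall fun z => hwb z.1)
  rw [Measure.volume_eq_prod] at hwW
  set G : Config n → ℂ := fun p => ∫ q, w q * W (q, p) with hG
  have hGi : Integrable G := hwW.integral_prod_right
  have hc0 : (2 * Real.pi * ħ) ≠ 0 := by positivity
  -- Both sums over k converge in L¹, in y and in q respectively, so the identity for single vectors
  -- passes to the sum.
  have hF : ∀ p, ∫ y, Complex.exp (-(Complex.I * ((⟪p, y⟫_ℝ / ħ : ℝ) : ℂ))) * h y =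
      ((2 * Real.pi * ħ) ^ n : ℝ) * G p := by
    intro p
    have hb : ∀ y : Config n, ‖Complex.exp (-(Complex.I * ((⟪p, y⟫_ℝ / ħ : ℝ) : ℂ)))‖ = 1 := by
      intro y
      rw [← mul_neg, ← Complex.ofReal_neg, norm_exp_I_mul_ofReal]
    have h1 := integral_tsum_of_summable_integral_norm (μ := volume)
      (F := fun k y => Complex.exp (-(Complex.I * ((⟪p, y⟫_ℝ / ħ : ℝ) : ℂ))) *
        autocorr w (φ k) y)
      (fun k => (integrable_autocorr hw (φ k)).bdd_mul (c := 1)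
        (Continuous.aestronglyMeasurable (by fun_prop)) (.of_forall fun y => (hb y).le))
      (by simpa only [norm_mul, hb, one_mul] using hsum)
    have h2 := integral_tsum_of_summable_integral_norm (μ := volume)
      (F := fun k q => w q * ⟪φ k, phasePointOp ħ (q, p) (φ k)⟫_ℂ)
      (fun k => integrable_mul_inner_phasePointOp hw (φ k) p)
      (by
        refine Summable.of_nonneg_of_le (fun k => integral_nonneg fun _ => norm_nonneg _)
          (fun k => ?_) (hφ.mul_left ((∫ q, ‖w q‖) * |((Real.pi * ħ) ^ n)⁻¹|))
        rw [mul_assoc, ← integral_mul_const]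
        refine integral_mono (integrable_mul_inner_phasePointOp hw (φ k) p).norm
          (hw.norm.mul_const _) fun q => ?_
        simp only [norm_mul]
        gcongr
        exact norm_inner_phasePointOp_le ħ _ _)
    simp only [tsum_mul_left, (hW _).tsum_eq] at h1 h2
    rw [hdef, ← h1, show G p = _ from h2.symm, ← tsum_mul_left]
    exact tsum_congr fun k => integral_exp_mul_autocorr hħ hw (φ k) p
  -- The kernel exp(-2πi⟨y, v⟩) of `Real.fourier_eq'` is exp(-i⟨p, y⟩/ħ) at p = 2πħv.
  have hFT : FourierTransform.fourier h =
      fun v => (((2 * Real.pi * ħ) ^ n : ℝ) : ℂ) * G ((2 * Real.pi * ħ) • v) := by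
    ext v
    rw [Real.fourier_eq', ← hF]
    refine integral_congr_ae (.of_forall fun y => ?_)
    simp only [smul_eq_mul]
    congr 2
    rw [inner_smul_left, mul_comm _ Complex.I, ← mul_neg, ← Complex.ofReal_neg, real_inner_comm]
    congr 2
    simp only [conj_trivial]
    field_simp
  -- Integrability of the transform is integrability of G, which comes from that of W by Fubini.
  have hinv := congrFun (hcont.fourierInv_fourier_eq hint (by
    rw [hFT]; exact (hGi.comp_smul hc0).const_mul _)) (ħ • b)
  rw [Real.fourierInv_eq', hFT] at hinv
  -- The Jacobian of p = 2πħv cancels the prefactor (2πħ)ⁿ.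
  have hsc := Measure.integral_comp_smul (volume : Measure (Config n))
    (fun p => Complex.exp (Complex.I * ((⟪b, p⟫_ℝ : ℝ) : ℂ)) * G p) (2 * Real.pi * ħ)
  have hlast : ∫ z : PhaseSpace n,
      W z * (w z.1 * Complex.exp (Complex.I * ((⟪b, z.2⟫_ℝ : ℝ) : ℂ))) =
      ∫ p, Complex.exp (Complex.I * ((⟪b, p⟫_ℝ : ℝ) : ℂ)) * G p := by
    rw [Measure.volume_eq_prod, integral_prod_symm]
    · refine integral_congr_ae (.of_forall fun p => ?_)
      simp only [hG, ← integral_const_mul]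
      refine integral_congr_ae (.of_forall fun q => ?_)
      simp only
      ring
    · have h3 := hwW.bdd_mul (c := 1)
        (f := fun z : PhaseSpace n => Complex.exp (Complex.I * ((⟪b, z.2⟫_ℝ : ℝ) : ℂ)))
        (Continuous.aestronglyMeasurable (by fun_prop))
        (.of_forall fun z => (norm_exp_I_mul_ofReal _).le)
      refine h3.congr (.of_forall fun z => ?_)
      simp only
      ring
  rw [hlast]
  rw [finrank_euclideanSpace_fin, abs_of_pos (by positivity), eq_inv_smul_iff₀ (by positivity),
    Complex.real_smul, ← integral_const_mul] at hsc
  rw [← hsc]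
  refine hinv.symm.trans (integral_congr_ae (.of_forall fun v => ?_))
  simp only [smul_eq_mul, inner_smul_right]
  rw [mul_left_comm, mul_comm Complex.I, real_inner_comm b v]
  ring_nf

/-- The Fourier transform of an integrable Wigner function is the characteristic function
`Tr(ρ exp(i(a·q̂ + b·p̂)))`. -/
theorem hasSum_inner_weylOp {ι : Type*} [Countable ι] {ħ : ℝ} (hħ : 0 < ħ)
    {φ : ι → WaveSpace n} (hφ : Summable fun k => ‖φ k‖ ^ 2) {W : PhaseSpace n → ℂ}
    (hW : ∀ z, HasSum (fun k => ⟪φ k, phasePointOp ħ z (φ k)⟫_ℂ) (W z)) (hWi : Integrable W)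
    (ξ : PhaseSpace n) :
    HasSum (fun k => ⟪φ k, weylOp ħ ξ (φ k)⟫_ℂ)
      (∫ z, W z * Complex.exp (Complex.I * (pairing ξ z : ℂ))) := by
  -- The weight is the character exp(i a·q) times a Gaussian cutoff: integrable for ε > 0, and of
  -- modulus one at ε = 0, where the autocorrelation is the Weyl matrix element.
  set w : ℝ → Config n → ℂ := fun ε q =>
    Complex.exp (-(ε : ℂ) * ‖q‖ ^ 2 + Complex.I * ((⟪ξ.1, q⟫_ℝ : ℝ) : ℂ)) with hwdef
  have hwc : ∀ ε, Continuous (w ε) := fun ε => by fun_prop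
  have hwn : ∀ ε q, ‖w ε q‖ = Real.exp (-(ε * ‖q‖ ^ 2)) := fun ε q => by
    rw [hwdef, Complex.norm_exp]
    congr 1
    simp [← Complex.ofReal_pow]
  have hwb : ∀ ε, 0 ≤ ε → ∀ q, ‖w ε q‖ ≤ 1 := fun ε hε q => by
    rw [hwn, Real.exp_le_one_iff, neg_nonpos]
    positivity
  have hwi : ∀ ε, 0 < ε → Integrable (w ε) := fun ε hε =>
    GaussianFourier.integrable_cexp_neg_mul_sq_norm_add (b := ε) (by simpa using hε) Complex.I ξ.1
  have hw0 : w 0 = fun q => Complex.exp (Complex.I * ((⟪ξ.1, q⟫_ℝ : ℝ) : ℂ)) := by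
    ext q; simp [hwdef]
  have hlim : ∀ q, Tendsto (fun ε => w ε q) (𝓝[>] 0) (𝓝 (w 0 q)) := fun q =>
    ((by simp only [hwdef]; fun_prop : Continuous fun ε => w ε q).tendsto 0).mono_left
      nhdsWithin_le_nhds
  have hL1 : ∀ k, Tendsto (fun ε => autocorr (w ε) (φ k) (ħ • ξ.2)) (𝓝[>] 0)
      (𝓝 (autocorr (w 0) (φ k) (ħ • ξ.2))) := by
    intro k
    refine tendsto_integral_filter_of_dominated_convergence
      (fun q => ‖wignerDensity (φ k) q (ħ • ξ.2)‖)
      (.of_forall fun ε => (hwc ε).aestronglyMeasurable.mul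
        (integrable_wignerDensity_left _ _).1) ?_ (integrable_wignerDensity_left _ _).norm
      (.of_forall fun q => (hlim q).mul_const _)
    filter_upwards [self_mem_nhdsWithin] with ε hε
    refine .of_forall fun q => ?_
    rw [norm_mul]
    exact mul_le_of_le_one_left (norm_nonneg _) (hwb ε (le_of_lt hε) q)
  have hL : Tendsto (fun ε => ∑' k, autocorr (w ε) (φ k) (ħ • ξ.2)) (𝓝[>] 0)
      (𝓝 (∑' k, autocorr (w 0) (φ k) (ħ • ξ.2))) := by
    refine tendsto_tsum_of_dominated_convergence hφ hL1 ?_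
    filter_upwards [self_mem_nhdsWithin] with ε hε k
    exact norm_autocorr_le (hwc ε) (hwb ε (le_of_lt hε)) _ _
  have hR : Tendsto (fun ε => ∫ z : PhaseSpace n,
      W z * (w ε z.1 * Complex.exp (Complex.I * ((⟪ξ.2, z.2⟫_ℝ : ℝ) : ℂ)))) (𝓝[>] 0)
      (𝓝 (∫ z : PhaseSpace n,
        W z * (w 0 z.1 * Complex.exp (Complex.I * ((⟪ξ.2, z.2⟫_ℝ : ℝ) : ℂ))))) := by
    refine tendsto_integral_filter_of_dominated_convergence (fun z => ‖W z‖) ?_ ?_ hWi.norm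
      (.of_forall fun z => ((hlim z.1).mul_const _).const_mul _)
    · refine .of_forall fun ε => hWi.1.mul (Continuous.aestronglyMeasurable ?_)
      have := hwc ε
      fun_prop
    · filter_upwards [self_mem_nhdsWithin] with ε hε
      refine .of_forall fun z => ?_
      rw [norm_mul, norm_mul, norm_exp_I_mul_ofReal, mul_one]
      exact mul_le_of_le_one_right (norm_nonneg _) (hwb ε (le_of_lt hε) _)
  have heq := tendsto_nhds_unique (hL.congr' (by
    filter_upwards [self_mem_nhdsWithin] with ε hε
    exact tsum_autocorr_eq_integral hħ hφ hW hWi (hwc ε) (hwb ε (le_of_lt hε)) (hwi ε hε) ξ.2)) hR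
  have hs : Summable fun k => ⟪φ k, weylOp ħ ξ (φ k)⟫_ℂ := by
    refine Summable.of_norm_bounded hφ fun k => ?_
    rw [inner_weylOp_self, ← hw0]
    exact norm_autocorr_le (hwc 0) (hwb 0 le_rfl) _ _
  have hfin : ∫ z, W z * Complex.exp (Complex.I * (pairing ξ z : ℂ)) =
      ∑' k, ⟪φ k, weylOp ħ ξ (φ k)⟫_ℂ := by
    simp only [inner_weylOp_self, ← hw0]
    rw [heq, hw0]
    refine integral_congr_ae (.of_forall fun z => ?_)
    simp only [pairing, ← Complex.exp_add]
    push_cast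
    ring_nf
  rw [hfin]
  exact hs.hasSum

end Fourier

/-! ### Difference quotients of Weyl operators -/

section Quotients

variable {n : ℕ}

/-- The unit vectors of phase space. -/
def canonicalUnit (i : Fin n ⊕ Fin n) : PhaseSpace n :=
  Sum.elim (fun k => (EuclideanSpace.single k 1, 0)) (fun k => (0, EuclideanSpace.single k 1)) i

theorem pairing_smul_canonicalUnit (t : ℝ) (i : Fin n ⊕ Fin n) (z : PhaseSpace n) :
    pairing (t • canonicalUnit i) z = t * coord i z := by
  rcases i with k | k <;>
    simp [pairing, canonicalUnit, coord, inner_smul_left, EuclideanSpace.inner_single_left]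

theorem pairing_sub (ξ η z : PhaseSpace n) : pairing (ξ - η) z = pairing ξ z - pairing η z := by
  simp only [pairing, Prod.fst_sub, Prod.snd_sub, inner_sub_left]
  ring

theorem pairing_zero_left (z : PhaseSpace n) : pairing 0 z = 0 := by simp [pairing]

theorem continuous_pairing (ξ : PhaseSpace n) : Continuous (pairing ξ) := by
  unfold pairing
  fun_prop

theorem continuous_coord (i : Fin n ⊕ Fin n) : Continuous (coord (n := n) i) := by
  unfold coord
  rcases i with k | k <;> dsimp only [Sum.elim_inl, Sum.elim_inr] <;> fun_prop

theorem symplectic_zero_left (η : PhaseSpace n) : symplectic 0 η = 0 := by simp [symplectic]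

theorem symplectic_zero_right (ξ : PhaseSpace n) : symplectic ξ 0 = 0 := by simp [symplectic]

/-- The minus sign appears because `Matrix.J` is -1 at (qₖ, pₖ), where the symplectic form is +1. -/
theorem symplectic_smul_canonicalUnit (s t : ℝ) (i j : Fin n ⊕ Fin n) :
    symplectic (t • canonicalUnit i) (s • canonicalUnit j) =
      t * s * -Matrix.J (Fin n) ℝ i j := by
  rcases i with k | k <;> rcases j with l | l <;>
    simp [symplectic, canonicalUnit, Matrix.J, inner_smul_left, inner_smul_right,
      EuclideanSpace.inner_single_left, Matrix.one_apply, eq_comm]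
  split_ifs <;> ring

/-- The difference quotient `(exp(itx) - 1)/(it)`. -/
def expSlope (t x : ℝ) : ℂ := (Complex.I * t)⁻¹ * (Complex.exp (Complex.I * (t * x : ℝ)) - 1)

/-- A bound uniform in t: it makes |zᵢW| and |zᵢzⱼW| the majorants for dominated convergence. At t =
0 the quotient is 0, by the convention for inverses. -/
theorem norm_expSlope_le (t x : ℝ) : ‖expSlope t x‖ ≤ |x| := by
  rcases eq_or_ne t 0 with rfl | ht
  · simp [expSlope]
  rw [expSlope, norm_mul, norm_inv, norm_mul, Complex.norm_I, one_mul, Complex.norm_real,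
    Real.norm_eq_abs, inv_mul_le_iff₀ (abs_pos.2 ht), ← abs_mul]
  exact Real.norm_exp_I_mul_ofReal_sub_one_le

theorem tendsto_expSlope (x : ℝ) : Tendsto (fun t => expSlope t x) (𝓝[≠] 0) (𝓝 (x : ℂ)) := by
  have h : HasDerivAt (fun t : ℝ => Complex.exp (Complex.I * (t * x : ℝ))) (Complex.I * x) 0 := by
    have h1 : HasDerivAt (fun t : ℝ => Complex.I * ((t * x : ℝ) : ℂ)) (Complex.I * x) 0 := by
      have h2 : HasDerivAt (fun t : ℝ => t * x) x 0 := by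
        simpa using (hasDerivAt_id (0 : ℝ)).mul_const x
      exact h2.ofReal_comp.const_mul Complex.I
    simpa using h1.cexp
  have h3 := (hasDerivAt_iff_tendsto_slope.1 h).const_mul (Complex.I)⁻¹
  rw [inv_mul_cancel_left₀ Complex.I_ne_zero] at h3
  refine h3.congr fun t => ?_
  simp only [slope, expSlope, vsub_eq_sub, sub_zero, zero_mul, Complex.ofReal_zero, mul_zero,
    Complex.exp_zero, Complex.real_smul, Complex.ofReal_inv, mul_inv]
  ring

theorem continuous_expSlope (t : ℝ) : Continuous (expSlope t) := by
  unfold expSlope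
  fun_prop

/-- The difference quotient `(exp(itẑᵢ) - 1)/(it)`. -/
def weylSlope (ħ : ℝ) (i : Fin n ⊕ Fin n) (t : ℝ) : WaveSpace n →L[ℂ] WaveSpace n :=
  (Complex.I * t)⁻¹ • (weylOp ħ (t • canonicalUnit i) - ContinuousLinearMap.id ℂ _)

/-- The Hilbert space of families of columns, which contains the Hilbert--Schmidt operators. -/
abbrev ColumnSpace (n : ℕ) : Type := lp (fun _ : basisIndex n => WaveSpace n) 2

/-! ### Hilbert–Schmidt inner products of Weyl operators and of their difference quotients, applied
to √ρ. -/

variable {ρ : WaveSpace n →L[ℂ] WaveSpace n}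

/-- The columns of `A √ρ`. -/
def columns (hρ : IsDensityOperator ρ) (A : WaveSpace n →L[ℂ] WaveSpace n) : ColumnSpace n :=
  ⟨fun k => A (sqrtCol ρ k), memℓp_gen (by
    simpa using summable_norm_map_sq (hasSum_norm_sqrtCol_sq hρ).summable A)⟩

theorem columns_apply (hρ : IsDensityOperator ρ) (A : WaveSpace n →L[ℂ] WaveSpace n)
    (k : basisIndex n) : columns hρ A k = A (sqrtCol ρ k) := rfl

/-- Writing the identity as the Weyl operator at 0 lets one formula, `inner_columns_weylOp`,
evaluate every term of an expanded inner product. -/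
theorem columns_weylSlope (hρ : IsDensityOperator ρ) (ħ : ℝ) (i : Fin n ⊕ Fin n) (t : ℝ) :
    columns hρ (weylSlope ħ i t) = (Complex.I * t)⁻¹ •
      (columns hρ (weylOp ħ (t • canonicalUnit i)) - columns hρ (weylOp ħ 0)) := by
  ext1
  funext k
  change weylSlope ħ i t (sqrtCol ρ k) = (Complex.I * t)⁻¹ •
    (weylOp ħ (t • canonicalUnit i) (sqrtCol ρ k) - weylOp ħ 0 (sqrtCol ρ k))
  rw [weylOp_zero]
  rfl

theorem inner_columns_weylOp (hρ : IsDensityOperator ρ) {ħ : ℝ} (hħ : 0 < ħ)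
    (hW : Integrable (wigner ħ ρ)) (ξ η : PhaseSpace n) :
    ⟪columns hρ (weylOp ħ ξ), columns hρ (weylOp ħ η)⟫_ℂ =
      Complex.exp (Complex.I * ((ħ / 2 * symplectic ξ η : ℝ) : ℂ)) *
        ∫ z, (wigner ħ ρ z : ℂ) * Complex.exp (Complex.I * (pairing (η - ξ) z : ℂ)) := by
  rw [lp.inner_eq_tsum, ← (hasSum_inner_weylOp hħ (hasSum_norm_sqrtCol_sq hρ).summable
    (hasSum_wigner hρ ħ) hW.ofReal (η - ξ)).tsum_eq, ← tsum_mul_left]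
  exact tsum_congr fun k => inner_weylOp_weylOp ħ ξ η _ _

theorem inner_columns_self (hρ : IsDensityOperator ρ) (ħ : ℝ) :
    ⟪columns hρ (weylOp ħ 0), columns hρ (weylOp ħ 0)⟫_ℂ = 1 := by
  rw [lp.inner_eq_tsum]
  simp only [columns_apply, weylOp_zero, inner_self_eq_norm_sq_to_K]
  have h := (hasSum_norm_sqrtCol_sq hρ).mapL Complex.ofRealCLM
  simpa using h.tsum_eq

/-- The Wigner function of a state is normalized. -/
theorem integral_wigner (hρ : IsDensityOperator ρ) {ħ : ℝ} (hħ : 0 < ħ)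
    (hW : Integrable (wigner ħ ρ)) : ∫ z, wigner ħ ρ z = 1 := by
  have h := inner_columns_weylOp hρ hħ hW 0 0
  rw [inner_columns_self] at h
  simp only [symplectic_zero_left, sub_zero, pairing_zero_left, mul_zero, Complex.ofReal_zero,
    Complex.exp_zero, mul_one, one_mul, integral_complex_ofReal] at h
  exact_mod_cast h.symm

theorem integrable_wigner_mul_exp {ħ : ℝ} (hW : Integrable (wigner ħ ρ)) (ξ : PhaseSpace n) :
    Integrable fun z => (wigner ħ ρ z : ℂ) * Complex.exp (Complex.I * (pairing ξ z : ℂ)) := by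
  have := continuous_pairing ξ
  exact hW.ofReal.mul_bdd (c := 1) (Continuous.aestronglyMeasurable (by fun_prop))
    (.of_forall fun z => (norm_exp_I_mul_ofReal _).le)

theorem inner_columns_weylSlope (hρ : IsDensityOperator ρ) {ħ : ℝ} (hħ : 0 < ħ)
    (hW : Integrable (wigner ħ ρ)) (i : Fin n ⊕ Fin n) (t : ℝ) :
    ⟪columns hρ (weylOp ħ 0), columns hρ (weylSlope ħ i t)⟫_ℂ =
      ∫ z, (wigner ħ ρ z : ℂ) * expSlope t (coord i z) := by
  have h1 := integrable_wigner_mul_exp hW (t • canonicalUnit i)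
  have h2 := integrable_wigner_mul_exp hW (0 : PhaseSpace n)
  rw [columns_weylSlope, inner_smul_right, inner_sub_right, inner_columns_weylOp hρ hħ hW,
    inner_columns_weylOp hρ hħ hW]
  simp only [symplectic_zero_left, sub_zero, mul_zero, Complex.ofReal_zero, Complex.exp_zero,
    one_mul]
  rw [← integral_sub h1 h2, ← integral_const_mul]
  refine integral_congr_ae (.of_forall fun z => ?_)
  simp only [expSlope, pairing_smul_canonicalUnit, pairing_zero_left, Complex.ofReal_zero,
    mul_zero, Complex.exp_zero]
  ring

/-- Of the four terms of the expansion only the one at η - ξ carries a phase. Replacing that phase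
by 1 leaves the product of the scalar quotients; the defect, phase minus 1 over ts, is again a
difference quotient, now with parameter ts, and is the source of the commutator. -/
theorem inner_columns_weylSlope_weylSlope (hρ : IsDensityOperator ρ) {ħ : ℝ} (hħ : 0 < ħ)
    (hW : Integrable (wigner ħ ρ)) (i j : Fin n ⊕ Fin n) (t s : ℝ) :
    ⟪columns hρ (weylSlope ħ i t), columns hρ (weylSlope ħ j s)⟫_ℂ =
      (∫ z, (wigner ħ ρ z : ℂ) * (conj (expSlope t (coord i z)) * expSlope s (coord j z))) +
      Complex.I * expSlope (t * s) (-(ħ / 2 * Matrix.J (Fin n) ℝ i j)) *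
        ∫ z, (wigner ħ ρ z : ℂ) *
          Complex.exp (Complex.I * ((s * coord j z - t * coord i z : ℝ) : ℂ)) := by
  obtain ⟨ξ, hξ⟩ : ∃ ξ, ξ = t • canonicalUnit i := ⟨_, rfl⟩
  obtain ⟨η, hη⟩ : ∃ η, η = s • canonicalUnit j := ⟨_, rfl⟩
  have h1 := integrable_wigner_mul_exp hW (η - ξ)
  have h2 := integrable_wigner_mul_exp hW (0 - ξ)
  have h3 := integrable_wigner_mul_exp hW (η - 0)
  have h4 := integrable_wigner_mul_exp hW (0 - 0 : PhaseSpace n)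
  have e1 : ∀ z, pairing (η - ξ) z = s * coord j z - t * coord i z := fun z => by
    rw [pairing_sub, hξ, hη, pairing_smul_canonicalUnit, pairing_smul_canonicalUnit]
  have e2 : ∀ z, pairing (0 - ξ) z = -(t * coord i z) := fun z => by
    rw [pairing_sub, hξ, pairing_smul_canonicalUnit, pairing_zero_left, zero_sub]
  have e3 : ∀ z, pairing (η - 0) z = s * coord j z := fun z => by
    rw [sub_zero, hη, pairing_smul_canonicalUnit]
  have e4 : ∀ z : PhaseSpace n, pairing (0 - 0) z = 0 := fun z => by
    rw [sub_zero, pairing_zero_left]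
  rw [columns_weylSlope, columns_weylSlope, ← hξ, ← hη, inner_smul_left, inner_smul_right, inner_sub_left,
    inner_sub_right, inner_sub_right]
  simp only [inner_columns_weylOp hρ hħ hW, symplectic_zero_left, symplectic_zero_right, mul_zero,
    Complex.ofReal_zero, Complex.exp_zero, one_mul]
  simp only [e1, e2, e3, e4] at h1 h2 h3 h4 ⊢
  have hc : conj ((Complex.I * t)⁻¹ : ℂ) * (Complex.I * s)⁻¹ = (t * s : ℂ)⁻¹ := by
    rw [map_inv₀, map_mul, Complex.conj_I, Complex.conj_ofReal, ← mul_inv]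
    congr 1
    linear_combination (-(t : ℂ) * s) * Complex.I_mul_I
  have hpt : ∀ z, (wigner ħ ρ z : ℂ) * (conj (expSlope t (coord i z)) * expSlope s (coord j z)) =
      (t * s : ℂ)⁻¹ * ((wigner ħ ρ z : ℂ) *
          Complex.exp (Complex.I * ((s * coord j z - t * coord i z : ℝ) : ℂ)) -
        (wigner ħ ρ z : ℂ) * Complex.exp (Complex.I * ((-(t * coord i z) : ℝ) : ℂ)) -
        ((wigner ħ ρ z : ℂ) * Complex.exp (Complex.I * ((s * coord j z : ℝ) : ℂ)) -
        (wigner ħ ρ z : ℂ) * Complex.exp (Complex.I * ((0 : ℝ) : ℂ)))) := by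
    intro z
    have h5 : conj (Complex.exp (Complex.I * ((t * coord i z : ℝ) : ℂ))) =
        Complex.exp (Complex.I * ((-(t * coord i z) : ℝ) : ℂ)) := by
      rw [← Complex.exp_conj, map_mul, Complex.conj_I, Complex.conj_ofReal, Complex.ofReal_neg,
        neg_mul, mul_neg]
    rw [sub_eq_neg_add (s * coord j z), Complex.ofReal_add, mul_add, Complex.exp_add, ← hc]
    simp only [expSlope]
    rw [map_mul, map_sub, map_one, h5, Complex.ofReal_zero, mul_zero, Complex.exp_zero]
    ring
  have hphase : Complex.I * expSlope (t * s) (-(ħ / 2 * Matrix.J (Fin n) ℝ i j)) =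
      (t * s : ℂ)⁻¹ * (Complex.exp (Complex.I * ((ħ / 2 * symplectic ξ η : ℝ) : ℂ)) - 1) := by
    rw [expSlope, mul_inv, ← mul_assoc, ← mul_assoc, mul_inv_cancel₀ Complex.I_ne_zero, one_mul,
      hξ, hη, symplectic_smul_canonicalUnit, Complex.ofReal_mul t s]
    congr 5
    ring
  have hI := integral_sub (h1.sub h2) (h3.sub h4)
  rw [integral_sub' h1 h2, integral_sub' h3 h4] at hI
  rw [integral_congr_ae (.of_forall hpt), integral_const_mul, hphase, ← hc]
  refine Eq.trans ?_ (congrArg (fun x => conj ((Complex.I * t)⁻¹ : ℂ) * (Complex.I * s)⁻¹ * x +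
    conj ((Complex.I * t)⁻¹ : ℂ) * (Complex.I * s)⁻¹ *
      (Complex.exp (Complex.I * ((ħ / 2 * symplectic ξ η : ℝ) : ℂ)) - 1) *
        ∫ z, (wigner ħ ρ z : ℂ) *
          Complex.exp (Complex.I * ((s * coord j z - t * coord i z : ℝ) : ℂ))) hI.symm)
  ring

theorem tendsto_inner_columns_weylSlope (hρ : IsDensityOperator ρ) {ħ : ℝ} (hħ : 0 < ħ)
    (hW : ClassicalSecondMomentsFinite (wigner ħ ρ)) (i : Fin n ⊕ Fin n) :
    Tendsto (fun t => ⟪columns hρ (weylOp ħ 0), columns hρ (weylSlope ħ i t)⟫_ℂ) (𝓝[≠] 0)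
      (𝓝 (classicalMean (wigner ħ ρ) i : ℂ)) := by
  simp only [inner_columns_weylSlope hρ hħ hW.1]
  rw [classicalMean, classicalExpect, ← integral_complex_ofReal]
  refine tendsto_integral_filter_of_dominated_convergence
    (fun z => ‖wigner ħ ρ z * coord i z‖) ?_ ?_ (hW.2.1 i).norm ?_
  · refine .of_forall fun t => hW.1.ofReal.1.mul (Continuous.aestronglyMeasurable ?_)
    exact (continuous_expSlope t).comp (continuous_coord i)
  · refine .of_forall fun t => .of_forall fun z => ?_
    rw [norm_mul, norm_mul, Complex.norm_real]
    gcongr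
    exact norm_expSlope_le _ _
  · refine .of_forall fun z => ?_
    rw [Complex.ofReal_mul]
    exact (tendsto_expSlope _).const_mul _

/-- The second moments `Tr(ρ ẑᵢ ẑⱼ)` as limits of difference quotients. -/
theorem tendsto_inner_columns_weylSlope_weylSlope (hρ : IsDensityOperator ρ) {ħ : ℝ} (hħ : 0 < ħ)
    (hW : ClassicalSecondMomentsFinite (wigner ħ ρ)) (i j : Fin n ⊕ Fin n) :
    Tendsto (fun u : ℝ × ℝ =>
        ⟪columns hρ (weylSlope ħ i u.1), columns hρ (weylSlope ħ j u.2)⟫_ℂ)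
      (𝓝[≠] 0 ×ˢ 𝓝[≠] 0)
      (𝓝 ((classicalExpect (wigner ħ ρ) (fun z => coord i z * coord j z) : ℝ) +
        Complex.I * ((-(ħ / 2 * Matrix.J (Fin n) ℝ i j) : ℝ) : ℂ))) := by
  -- The phase term has parameter u.1 * u.2, which must tend to 0 without vanishing, since
  -- `expSlope` at parameter 0 is 0 and not the limit.
  have hne : ∀ᶠ u : ℝ × ℝ in 𝓝[≠] 0 ×ˢ 𝓝[≠] 0, u.1 ≠ 0 ∧ u.2 ≠ 0 :=
    (eventually_mem_nhdsWithin (a := (0 : ℝ)) (s := {0}ᶜ)).prod_mk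
      (eventually_mem_nhdsWithin (a := (0 : ℝ)) (s := {0}ᶜ))
  have h0 : (𝓝[≠] 0 ×ˢ 𝓝[≠] 0 : Filter (ℝ × ℝ)) ≤ 𝓝 (0, 0) := by
    rw [nhds_prod_eq]
    exact prod_mono nhdsWithin_le_nhds nhdsWithin_le_nhds
  refine Tendsto.congr' (f₁ := fun u : ℝ × ℝ =>
      (∫ z, (wigner ħ ρ z : ℂ) *
        (conj (expSlope u.1 (coord i z)) * expSlope u.2 (coord j z))) +
      Complex.I * expSlope (u.1 * u.2) (-(ħ / 2 * Matrix.J (Fin n) ℝ i j)) *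
        ∫ z, (wigner ħ ρ z : ℂ) *
          Complex.exp (Complex.I * ((u.2 * coord j z - u.1 * coord i z : ℝ) : ℂ))) ?_ ?_
  · exact .of_forall fun u => (inner_columns_weylSlope_weylSlope hρ hħ hW.1 i j u.1 u.2).symm
  refine Tendsto.add ?_ ?_
  · rw [classicalExpect, ← integral_complex_ofReal]
    refine tendsto_integral_filter_of_dominated_convergence
      (fun z => ‖wigner ħ ρ z * (coord i z * coord j z)‖) ?_ ?_ (hW.2.2 i j).norm ?_
    · refine .of_forall fun u => hW.1.ofReal.1.mul (Continuous.aestronglyMeasurable ?_)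
      exact (Complex.continuous_conj.comp ((continuous_expSlope _).comp (continuous_coord i))).mul
        ((continuous_expSlope _).comp (continuous_coord j))
    · refine .of_forall fun u => .of_forall fun z => ?_
      rw [norm_mul, norm_mul, norm_mul, norm_mul, Complex.norm_real, RCLike.norm_conj]
      gcongr
      · exact norm_expSlope_le _ _
      · exact norm_expSlope_le _ _
    · refine .of_forall fun z => ?_
      rw [Complex.ofReal_mul, Complex.ofReal_mul]
      refine Tendsto.const_mul _ (Tendsto.mul ?_ ((tendsto_expSlope _).comp tendsto_snd))
      rw [← Complex.conj_ofReal (coord i z)]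
      exact (Complex.continuous_conj.tendsto _).comp ((tendsto_expSlope _).comp tendsto_fst)
  · rw [← mul_one (Complex.I * _)]
    refine Tendsto.mul (Tendsto.const_mul _ ?_) ?_
    · refine (tendsto_expSlope _).comp (tendsto_nhdsWithin_iff.2 ⟨?_, ?_⟩)
      · simpa using (continuous_mul.tendsto ((0 : ℝ), (0 : ℝ))).mono_left h0
      · filter_upwards [hne] with u hu
        exact mul_ne_zero hu.1 hu.2
    · have h1 : (1 : ℂ) = ∫ z, (wigner ħ ρ z : ℂ) := by
        rw [integral_complex_ofReal, integral_wigner hρ hħ hW.1, Complex.ofReal_one]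
      rw [h1]
      refine tendsto_integral_filter_of_dominated_convergence (fun z => ‖wigner ħ ρ z‖) ?_ ?_
        hW.1.norm ?_
      · have hi := continuous_coord i
        have hj := continuous_coord j
        exact .of_forall fun u => hW.1.ofReal.1.mul (Continuous.aestronglyMeasurable (by fun_prop))
      · refine .of_forall fun u => .of_forall fun z => ?_
        rw [norm_mul, norm_exp_I_mul_ofReal, mul_one, Complex.norm_real]
      · refine .of_forall fun z => ?_
        have hc : Continuous fun u : ℝ × ℝ => (wigner ħ ρ z : ℂ) *
          Complex.exp (Complex.I * ((u.2 * coord j z - u.1 * coord i z : ℝ) : ℂ)) := by fun_prop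
        simpa using (hc.tendsto (0, 0)).mono_left h0

/-- The columns of the difference quotients converge in Hilbert--Schmidt norm. -/
theorem exists_tendsto_columns_weylSlope (hρ : IsDensityOperator ρ) {ħ : ℝ} (hħ : 0 < ħ)
    (hW : ClassicalSecondMomentsFinite (wigner ħ ρ)) (i : Fin n ⊕ Fin n) :
    ∃ X : ColumnSpace n, Tendsto (fun t => columns hρ (weylSlope ħ i t)) (𝓝[≠] 0) (𝓝 X) := by
  rw [← cauchy_map_iff_exists_tendsto, cauchy_map_iff]
  refine ⟨inferInstance, ?_⟩
  rw [tendsto_uniformity_iff_dist_tendsto_zero]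
  have h := tendsto_inner_columns_weylSlope_weylSlope hρ hħ hW i i
  set L := ((classicalExpect (wigner ħ ρ) (fun z => coord i z * coord i z) : ℝ) : ℂ) +
        Complex.I * ((-(ħ / 2 * Matrix.J (Fin n) ℝ i i) : ℝ) : ℂ)
  have h11 := h.comp ((tendsto_fst (f := 𝓝[≠] (0 : ℝ)) (g := 𝓝[≠] (0 : ℝ))).prodMk tendsto_fst)
  have h22 := h.comp ((tendsto_snd (f := 𝓝[≠] (0 : ℝ)) (g := 𝓝[≠] (0 : ℝ))).prodMk tendsto_snd)
  have h21 := h.comp ((tendsto_snd (f := 𝓝[≠] (0 : ℝ)) (g := 𝓝[≠] (0 : ℝ))).prodMk tendsto_fst)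
  -- All four inner products in the expansion of ‖a - b‖² have the same joint limit L, so the
  -- alternating sum tends to 0.
  have hsq := (Complex.continuous_re.tendsto _).comp ((h11.sub h).sub (h21.sub h22))
  have hd : Tendsto (fun u : ℝ × ℝ =>
      ‖columns hρ (weylSlope ħ i u.1) - columns hρ (weylSlope ħ i u.2)‖ ^ 2)
      (𝓝[≠] 0 ×ˢ 𝓝[≠] 0) (𝓝 0) := by
    simp only [sub_self, Complex.zero_re] at hsq
    refine hsq.congr fun u => ?_
    rw [← inner_self_eq_norm_sq (𝕜 := ℂ), inner_sub_left, inner_sub_right, inner_sub_right]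
    rfl
  have := hd.sqrt
  simpa only [Real.sqrt_zero, Real.sqrt_sq (norm_nonneg _), dist_eq_norm] using this

/-- Hilbert--Schmidt convergence of the difference quotients implies strong convergence. -/
theorem exists_tendsto_weylSlope_opSqrt (hρ : IsDensityOperator ρ) {ħ : ℝ} {i : Fin n ⊕ Fin n}
    {X : ColumnSpace n} (hX : Tendsto (fun t => columns hρ (weylSlope ħ i t)) (𝓝[≠] 0) (𝓝 X))
    (ψ : WaveSpace n) :
    ∃ χ, Tendsto (fun t => weylSlope ħ i t (opSqrt ρ ψ)) (𝓝[≠] 0) (𝓝 χ) := by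
  -- The operator norm of (A_t - A_s)√ρ is at most its Hilbert–Schmidt norm, so the Cauchy property
  -- passes to each vector.
  have hle : ∀ t s, dist (weylSlope ħ i t (opSqrt ρ ψ)) (weylSlope ħ i s (opSqrt ρ ψ)) ≤
      ‖ψ‖ * dist (columns hρ (weylSlope ħ i t)) (columns hρ (weylSlope ħ i s)) := by
    intro t s
    set A := weylSlope ħ i t - weylSlope ħ i s with hA
    have h1 : columns hρ (weylSlope ħ i t) - columns hρ (weylSlope ħ i s) = columns hρ A := rfl
    have h2 := norm_sq_le_of_hilbertSchmidt (waveBasis n) (A ∘L opSqrt ρ)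
      (summable_norm_map_sq (hasSum_norm_sqrtCol_sq hρ).summable A) ψ
    have h3 : ∑' k, ‖(A ∘L opSqrt ρ) (waveBasis n k)‖ ^ 2 = ‖columns hρ A‖ ^ 2 := by
      have := lp.norm_rpow_eq_tsum (p := 2) (by norm_num) (columns hρ A)
      simp only [ENNReal.toReal_ofNat, Real.rpow_ofNat] at this
      exact this.symm
    rw [h3, ← mul_pow] at h2
    rw [dist_eq_norm, dist_eq_norm, h1]
    exact le_of_sq_le_sq h2 (by positivity)
  have hc : Cauchy (map (fun t => columns hρ (weylSlope ħ i t)) (𝓝[≠] 0)) := hX.cauchy_map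
  rw [cauchy_map_iff, tendsto_uniformity_iff_dist_tendsto_zero] at hc
  rw [← cauchy_map_iff_exists_tendsto, cauchy_map_iff, tendsto_uniformity_iff_dist_tendsto_zero]
  refine ⟨inferInstance, squeeze_zero (fun _ => dist_nonneg) (fun u => hle u.1 u.2) ?_⟩
  simpa using hc.2.const_mul ‖ψ‖

theorem tendsto_weylSlope_sqrtCol (hρ : IsDensityOperator ρ) {ħ : ℝ} {i : Fin n ⊕ Fin n}
    {X : ColumnSpace n} (hX : Tendsto (fun t => columns hρ (weylSlope ħ i t)) (𝓝[≠] 0) (𝓝 X))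
    (k : basisIndex n) :
    Tendsto (fun t => weylSlope ħ i t (sqrtCol ρ k)) (𝓝[≠] 0) (𝓝 (X k)) := by
  rw [tendsto_iff_norm_sub_tendsto_zero] at hX ⊢
  exact squeeze_zero (fun _ => norm_nonneg _)
    (fun t => lp.norm_apply_le_norm (by norm_num) (columns hρ (weylSlope ħ i t) - X) k) hX

end Quotients

/-! ### Generators of the Weyl operators -/

section Generators

variable {n : ℕ}

theorem coeFn_weylSlope (ħ : ℝ) (i : Fin n ⊕ Fin n) (t : ℝ) (ψ : WaveSpace n) :
    weylSlope ħ i t ψ =ᵐ[volume] fun x => (Complex.I * t)⁻¹ *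
      (weylOp ħ (t • canonicalUnit i) ψ x - ψ x) := by
  have h : weylSlope ħ i t ψ = (Complex.I * t : ℂ)⁻¹ • (weylOp ħ (t • canonicalUnit i) ψ - ψ) := rfl
  rw [h]
  filter_upwards [Lp.coeFn_smul (Complex.I * t : ℂ)⁻¹ (weylOp ħ (t • canonicalUnit i) ψ - ψ),
    Lp.coeFn_sub (weylOp ħ (t • canonicalUnit i) ψ) ψ] with x h1 h2
  rw [h1, Pi.smul_apply, h2, Pi.sub_apply, smul_eq_mul]

theorem coeFn_weylSlope_inl (ħ : ℝ) (k : Fin n) (t : ℝ) (ψ : WaveSpace n) :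
    weylSlope ħ (Sum.inl k) t ψ =ᵐ[volume] fun x => expSlope t (x k) * ψ x := by
  filter_upwards [coeFn_weylSlope ħ (Sum.inl k) t ψ,
    coeFn_weylOp ħ (t • canonicalUnit (Sum.inl k)) ψ] with x h1 h2
  have h3 : ⟪(t • canonicalUnit (n := n) (Sum.inl k)).1, x⟫_ℝ = t * x k := by
    simp [canonicalUnit, inner_smul_left, EuclideanSpace.inner_single_left]
  have h4 : (t • canonicalUnit (n := n) (Sum.inl k)).2 = 0 := by simp [canonicalUnit]
  rw [h1, h2, h4, smul_zero, smul_zero, add_zero, h3, expSlope]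
  ring

theorem coeFn_weylSlope_inr (ħ : ℝ) (k : Fin n) (t : ℝ) (ψ : WaveSpace n) :
    weylSlope ħ (Sum.inr k) t ψ =ᵐ[volume] fun x => (Complex.I * t)⁻¹ *
      (ψ (x + (ħ * t) • EuclideanSpace.single k 1) - ψ x) := by
  filter_upwards [coeFn_weylSlope ħ (Sum.inr k) t ψ,
    coeFn_weylOp ħ (t • canonicalUnit (Sum.inr k)) ψ] with x h1 h2
  have h3 : (t • canonicalUnit (n := n) (Sum.inr k)).1 = 0 := by simp [canonicalUnit]
  have h4 : ħ • (t • canonicalUnit (n := n) (Sum.inr k)).2 =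
      (ħ * t) • EuclideanSpace.single k 1 := by
    rw [mul_smul]
    simp [canonicalUnit]
  rw [h1, h2, h4, h3, inner_zero_left]
  simp

/-- An L² limit is an almost everywhere limit along a subsequence, and pointwise the quotients tend
to x_k ψ(x). Passing to t = 1/(m + 1) keeps the exceptional null sets countable in number. -/
theorem mem_positionGraph_of_tendsto {ħ : ℝ} {k : Fin n} {ψ χ : WaveSpace n}
    (h : Tendsto (fun t => weylSlope ħ (Sum.inl k) t ψ) (𝓝[≠] 0) (𝓝 χ)) :
    (ψ, χ) ∈ positionGraph k := by
  have hseq : Tendsto (fun m : ℕ => (1 / ((m : ℝ) + 1))) atTop (𝓝[≠] 0) :=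
    tendsto_nhdsWithin_iff.2 ⟨tendsto_one_div_add_atTop_nhds_zero_nat,
      .of_forall fun m => by simp only [Set.mem_compl_iff, Set.mem_singleton_iff]; positivity⟩
  obtain ⟨u, hu, hae⟩ :=
    (tendstoInMeasure_of_tendsto_Lp (h.comp hseq)).exists_seq_tendsto_ae
  have hall : ∀ᵐ x ∂(volume : Measure (Config n)), ∀ m : ℕ,
      weylSlope ħ (Sum.inl k) (1 / ((m : ℝ) + 1)) ψ x =
        expSlope (1 / ((m : ℝ) + 1)) (x k) * ψ x :=
    ae_all_iff.2 fun m => coeFn_weylSlope_inl ħ k _ ψ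
  change ∀ᵐ x ∂(volume : Measure (Config n)), χ x = (x k : ℂ) * ψ x
  filter_upwards [hae, hall] with x h1 h2
  refine tendsto_nhds_unique h1 ?_
  have h3 := ((tendsto_expSlope (x k)).comp (hseq.comp hu.tendsto_atTop)).mul_const (ψ x)
  exact h3.congr fun m => (h2 (u m)).symm

theorem partialDeriv_eq_zero_of_notMem {k : Fin n} {η : Config n → ℝ} {x : Config n}
    (hx : x ∉ tsupport η) : partialDeriv k η x = 0 := by
  rw [partialDeriv, fderiv_of_notMem_tsupport ℝ hx]
  rfl

/-- Differentiation of a smooth test function under the integral. -/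
theorem hasDerivAt_integral_translate (k : Fin n) {η : Config n → ℝ} (hη : ContDiff ℝ ∞ η)
    (hs : HasCompactSupport η) (ψ : WaveSpace n) :
    HasDerivAt (fun s : ℝ => ∫ x, η (x - s • EuclideanSpace.single k 1) • ψ x)
      (-∫ x, partialDeriv k η x • ψ x) 0 := by
  set e : Config n := EuclideanSpace.single k 1 with he
  have hd : Continuous (partialDeriv k η) :=
    (hη.continuous_fderiv (by simp)).clm_apply continuous_const
  obtain ⟨C, hC⟩ := (hs.fderiv_apply ℝ e).exists_bound_of_continuous (f := partialDeriv k η) hd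
  have hK : IsCompact (Metric.cthickening 1 (tsupport η)) := hs.isCompact.cthickening
  have hψ : LocallyIntegrable ψ (volume : Measure (Config n)) :=
    (Lp.memLp ψ).locallyIntegrable (by norm_num)
  have hshift : ∀ s : ℝ, HasCompactSupport fun x => η (x - s • e) := fun s =>
    hs.comp_homeomorph (Homeomorph.subRight (s • e))
  have key := hasDerivAt_integral_of_dominated_loc_of_deriv_le (μ := volume) (𝕜 := ℝ)
    (F := fun s x => η (x - s • e) • ψ x) (F' := fun s x => (-partialDeriv k η (x - s • e)) • ψ x)
    (x₀ := 0) (s := Metric.ball 0 1)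
    -- For |s| < 1 the translated test functions all live on this compact set, where ψ, being
    -- locally integrable, is integrable.
    (bound := (Metric.cthickening 1 (tsupport η)).indicator fun x => C * ‖ψ x‖)
    (Metric.ball_mem_nhds 0 one_pos)
    (.of_forall fun s => (integrable_smul_wave
      (hη.continuous.comp (by fun_prop)) (hshift s) ψ).aestronglyMeasurable)
    (integrable_smul_wave (hη.continuous.comp (by fun_prop)) (hshift 0) ψ)
    (((hd.comp (continuous_id.sub continuous_const)).neg.aestronglyMeasurable).smul
      (Lp.aestronglyMeasurable ψ))
    (.of_forall fun x s hsb => ?_)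
    ((integrable_indicator_iff hK.measurableSet).2 ((hψ.integrableOn_isCompact hK).norm.const_mul C))
    (.of_forall fun x s hsb => ?_)
  · have h2 := key.2
    simp only [zero_smul, sub_zero, neg_smul] at h2
    rwa [integral_neg] at h2
  · by_cases hx : x ∈ Metric.cthickening 1 (tsupport η)
    · rw [Set.indicator_of_mem hx, norm_smul, norm_neg]
      gcongr
      exact hC _
    · rw [Set.indicator_of_notMem hx, partialDeriv_eq_zero_of_notMem]
      · simp
      · intro hmem
        refine hx (Metric.mem_cthickening_of_dist_le x (x - s • e) 1 _ hmem ?_)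
        rw [dist_eq_norm, sub_sub_cancel, norm_smul, he, PiLp.norm_single, norm_one, mul_one]
        rw [mem_ball_zero_iff] at hsb
        exact hsb.le
  · refine HasDerivAt.smul_const ?_ (ψ x)
    have h1 : HasDerivAt (fun s : ℝ => x - s • e) (-e) s := by
      simpa using ((hasDerivAt_id s).smul_const e).const_sub x
    have h2 := ((hη.differentiable (by simp)) (x - s • e)).hasFDerivAt.comp_hasDerivAt s h1
    rw [map_neg] at h2
    exact h2

/-- Against a test function the translation moves from ψ onto η, where the difference quotient
converges to a derivative; this is exactly the weak definition of p̂. -/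
theorem mem_momentumGraph_of_tendsto {ħ : ℝ} {k : Fin n} {ψ χ : WaveSpace n}
    (h : Tendsto (fun t => weylSlope ħ (Sum.inr k) t ψ) (𝓝[≠] 0) (𝓝 χ)) :
    (ψ, χ) ∈ momentumGraph ħ k := by
  intro η hη hs
  have hηL : MemLp (fun x => (η x : ℂ)) 2 (volume : Measure (Config n)) :=
    (hη.continuous.memLp_of_hasCompactSupport hs).ofReal
  have hinner : ∀ φ : WaveSpace n, ⟪hηL.toLp _, φ⟫_ℂ = ∫ x, η x • φ x := by
    intro φ
    rw [L2.inner_def]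
    refine integral_congr_ae ?_
    filter_upwards [hηL.coeFn_toLp] with x hx
    rw [RCLike.inner_apply, hx, Complex.conj_ofReal, Complex.real_smul, mul_comm]
  have h1 : Tendsto (fun t => ∫ x, η x • weylSlope ħ (Sum.inr k) t ψ x) (𝓝[≠] 0)
      (𝓝 (∫ x, η x • χ x)) := by
    simp only [← hinner]
    exact tendsto_const_nhds.inner h
  refine tendsto_nhds_unique h1 ?_
  set e : Config n := EuclideanSpace.single k 1 with he
  have hshift : ∀ s : ℝ, HasCompactSupport fun x => η (x - s • e) := fun s =>
    hs.comp_homeomorph (Homeomorph.subRight (s • e))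
  set f : ℝ → ℂ := fun s => ∫ x, η (x - s • e) • ψ x with hf
  have hquot : ∀ t, ∫ x, η x • weylSlope ħ (Sum.inr k) t ψ x =
      (Complex.I * t)⁻¹ * (f (ħ * t) - f 0) := by
    intro t
    have h2 : ∫ x, η x • weylSlope ħ (Sum.inr k) t ψ x =
        ∫ x, (Complex.I * t)⁻¹ * (η x • ψ (x + (ħ * t) • e) - η x • ψ x) := by
      refine integral_congr_ae ?_
      filter_upwards [coeFn_weylSlope_inr ħ k t ψ] with x hx
      simp only [hx, Complex.real_smul]
      ring
    have h3 : Integrable fun x => η (x - (ħ * t) • e) • ψ x :=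
      integrable_smul_wave (hη.continuous.comp (by fun_prop)) (hshift _) ψ
    have h4 : Integrable fun x => η x • ψ (x + (ħ * t) • e) := by
      simpa using h3.comp_add_right ((ħ * t) • e)
    have h5 : f (ħ * t) = ∫ x, η x • ψ (x + (ħ * t) • e) := by
      have h := integral_add_right_eq_self (μ := volume)
        (fun x => η (x - (ħ * t) • e) • ψ x) ((ħ * t) • e)
      simp only [add_sub_cancel_right] at h
      exact h.symm
    have h6 : f 0 = ∫ x, η x • ψ x := by simp [hf]
    rw [h2, integral_const_mul, integral_sub h4 (integrable_smul_wave hη.continuous hs ψ), h5, h6]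
  simp only [hquot]
  have hder : HasDerivAt f (-∫ x, partialDeriv k η x • ψ x) (ħ * 0) := by
    rw [mul_zero]
    exact hasDerivAt_integral_translate k hη hs ψ
  have hder2 : HasDerivAt (fun t : ℝ => f (ħ * t)) (ħ • -∫ x, partialDeriv k η x • ψ x) 0 :=
    hder.scomp 0 (by simpa using (hasDerivAt_id (0 : ℝ)).const_mul ħ)
  have h7 := (hasDerivAt_iff_tendsto_slope.1 hder2).const_mul (Complex.I)⁻¹
  -- The factor ħ comes from the step ħt of the translation, and -i⁻¹ = i.
  have h8 : Complex.I⁻¹ * (ħ • -∫ x, partialDeriv k η x • ψ x) =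
      Complex.I * ħ * ∫ x, partialDeriv k η x • ψ x := by
    rw [Complex.inv_I, Complex.real_smul]
    ring
  rw [h8] at h7
  refine h7.congr fun t => ?_
  simp only [slope, vsub_eq_sub, sub_zero, mul_zero, Complex.real_smul, Complex.ofReal_inv, mul_inv]
  ring

theorem mem_canonicalGraph_of_tendsto {ħ : ℝ} {i : Fin n ⊕ Fin n}
    {ψ χ : WaveSpace n} (h : Tendsto (fun t => weylSlope ħ i t ψ) (𝓝[≠] 0) (𝓝 χ)) :
    (ψ, χ) ∈ canonicalGraph ħ i := by
  rcases i with k | k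
  · exact mem_positionGraph_of_tendsto h
  · exact mem_momentumGraph_of_tendsto h

theorem mem_domain_of_mem_canonicalGraph {ħ : ℝ} {i : Fin n ⊕ Fin n} {ψ χ : WaveSpace n}
    (h : (ψ, χ) ∈ canonicalGraph ħ i) : ψ ∈ (canonicalOp ħ i).domain :=
  LinearPMap.mem_domain_of_mem_graph (by rwa [canonicalOp_graph])

theorem canonicalApply_eq_of_mem_canonicalGraph {ħ : ℝ} {i : Fin n ⊕ Fin n} {ψ χ : WaveSpace n}
    (h : (ψ, χ) ∈ canonicalGraph ħ i) : canonicalApply ħ i ψ = χ := by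
  have hd := mem_domain_of_mem_canonicalGraph h
  rw [canonicalApply, dif_pos hd]
  rw [← canonicalOp_graph] at h
  exact ((LinearPMap.image_iff hd).2 h).symm

end Generators

/-! ### Moments of the state and of its Wigner function -/

section Moments

variable {n : ℕ} {ρ : WaveSpace n →L[ℂ] WaveSpace n} {ħ : ℝ}

theorem classicalCov_apply {μ : PhaseSpace n → ℝ} (hμ : ClassicalSecondMomentsFinite μ)
    (h1 : ∫ z, μ z = 1) (i j : Fin n ⊕ Fin n) :
    classicalCov μ i j = 2 * (classicalExpect μ (fun z => coord i z * coord j z) -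
      classicalMean μ i * classicalMean μ j) := by
  set a := classicalMean μ i with ha
  set b := classicalMean μ j with hb
  have e : ∀ z, μ z * ((coord i z - a) * (coord j z - b)) =
      (μ z * (coord i z * coord j z) - b * (μ z * coord i z)) -
        (a * (μ z * coord j z) - a * b * μ z) := fun z => by ring
  have hij := hμ.2.2 i j
  have hi := (hμ.2.1 i).const_mul b
  have hj := (hμ.2.1 j).const_mul a
  have h0 := hμ.1.const_mul (a * b)
  have h : ∫ z, μ z * ((coord i z - a) * (coord j z - b)) =
      classicalExpect μ (fun z => coord i z * coord j z) - a * b := by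
    rw [integral_congr_ae (.of_forall e)]
    refine (integral_sub (hij.sub hi) (hj.sub h0)).trans ?_
    rw [integral_sub' hij hi, integral_sub' hj h0, integral_const_mul, integral_const_mul,
      integral_const_mul, h1]
    have e1 : ∫ z, μ z * coord i z = a := rfl
    have e2 : ∫ z, μ z * coord j z = b := rfl
    have e3 : ∫ z, μ z * (coord i z * coord j z) =
      classicalExpect μ (fun z => coord i z * coord j z) := rfl
    rw [e1, e2, e3]
    ring
  exact congrArg (2 * ·) h

/-- If the Wigner function has finite second moments, then so has the state, and its first and
second moments, with their antisymmetric part, are those of the Wigner function. -/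
theorem quantum_moments_of_wigner (hħ : 0 < ħ) (hρ : IsDensityOperator ρ)
    (hW : ClassicalSecondMomentsFinite (wigner ħ ρ)) :
    QuantumSecondMomentsFinite ħ ρ ∧
    (∀ i, quantumMean ħ ρ i = (classicalMean (wigner ħ ρ) i : ℂ)) ∧
    ∃ C : Fin n ⊕ Fin n → ColumnSpace n, (∀ i k, C i k = centeredCol ħ ρ i k) ∧
      ∀ i j, ⟪C i, C j⟫_ℂ = ((classicalCov (wigner ħ ρ) i j / 2 : ℝ) : ℂ) -
        Complex.I * ((ħ / 2 * Matrix.J (Fin n) ℝ i j : ℝ) : ℂ) := by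
  choose X hX using fun i => exists_tendsto_columns_weylSlope hρ hħ hW i
  have hcol : ∀ i k, canonicalApply ħ i (sqrtCol ρ k) = X i k := fun i k =>
    canonicalApply_eq_of_mem_canonicalGraph
      (mem_canonicalGraph_of_tendsto (tendsto_weylSlope_sqrtCol hρ (hX i) k))
  set Φ := columns hρ (weylOp ħ 0) with hΦ
  have hΦk : ∀ k, Φ k = sqrtCol ρ k := fun k => by rw [hΦ, columns_apply, weylOp_zero]
  have hΦX : ∀ i, ⟪Φ, X i⟫_ℂ = (classicalMean (wigner ħ ρ) i : ℂ) := fun i =>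
    tendsto_nhds_unique (tendsto_const_nhds.inner (hX i))
      (tendsto_inner_columns_weylSlope hρ hħ hW i)
  have hXX : ∀ i j, ⟪X i, X j⟫_ℂ =
      (classicalExpect (wigner ħ ρ) (fun z => coord i z * coord j z) : ℝ) +
        Complex.I * ((-(ħ / 2 * Matrix.J (Fin n) ℝ i j) : ℝ) : ℂ) := fun i j =>
    tendsto_nhds_unique (((hX i).comp tendsto_fst).inner ((hX j).comp tendsto_snd))
      (tendsto_inner_columns_weylSlope_weylSlope hρ hħ hW i j)
  have hmean : ∀ i, quantumMean ħ ρ i = (classicalMean (wigner ħ ρ) i : ℂ) := fun i => by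
    rw [← hΦX, lp.inner_eq_tsum, quantumMean]
    exact tsum_congr fun k => by rw [hcol, hΦk]
  refine ⟨fun i => ⟨fun ψ => ?_, ?_⟩, hmean,
    fun i => X i - (classicalMean (wigner ħ ρ) i : ℂ) • Φ, fun i k => ?_, fun i j => ?_⟩
  · obtain ⟨χ, hχ⟩ := exists_tendsto_weylSlope_opSqrt hρ (hX i) ψ
    exact mem_domain_of_mem_canonicalGraph (mem_canonicalGraph_of_tendsto hχ)
  · have h := (lp.memℓp (X i)).summable (by norm_num)
    simp only [hcol]
    simpa using h
  · rw [centeredCol, hmean, hcol, ← hΦk]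
    rfl
  · have hXΦ : ⟪X i, Φ⟫_ℂ = (classicalMean (wigner ħ ρ) i : ℂ) := by
      rw [← inner_conj_symm, hΦX, Complex.conj_ofReal]
    rw [inner_sub_left, inner_sub_right, inner_sub_right, inner_smul_left, inner_smul_left,
      inner_smul_right, inner_smul_right, hXΦ, hΦX, hXX, hΦ, inner_columns_self,
      Complex.conj_ofReal, classicalCov_apply hW (integral_wigner hρ hħ hW.1)]
    push_cast
    ring

theorem quantumCov_eq_classicalCov (hħ : 0 < ħ) (hρ : IsDensityOperator ρ)
    (hW : ClassicalSecondMomentsFinite (wigner ħ ρ)) :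
    quantumCov ħ ρ = classicalCov (wigner ħ ρ) := by
  obtain ⟨-, -, C, hC, hCC⟩ := quantum_moments_of_wigner hħ hρ hW
  ext i j
  have h : ∑' k, ⟪centeredCol ħ ρ i k, centeredCol ħ ρ j k⟫_ℂ = ⟪C i, C j⟫_ℂ := by
    rw [lp.inner_eq_tsum]
    exact tsum_congr fun k => by rw [hC, hC]
  rw [quantumCov, Matrix.of_apply, h, hCC]
  simp only [Complex.sub_re, Complex.ofReal_re, Complex.mul_re, Complex.I_re, Complex.I_im,
    Complex.ofReal_im, zero_mul, one_mul, sub_zero]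
  ring

/-- Any state whose Wigner function has finite second moments qualifies; the Gaussian form plays no
role here. The Gram matrix carries -iħΣ/2, and its transpose has the required sign. -/
theorem posSemidef_classicalCov_add (hħ : 0 < ħ) (hρ : IsDensityOperator ρ)
    (hW : ClassicalSecondMomentsFinite (wigner ħ ρ)) :
    ((classicalCov (wigner ħ ρ)).map Complex.ofReal +
      (Complex.I * (ħ : ℂ)) • Matrix.J (Fin n) ℂ).PosSemidef := by
  obtain ⟨-, -, C, -, hCC⟩ := quantum_moments_of_wigner hħ hρ hW
  have hJ : ∀ i j, Matrix.J (Fin n) ℂ i j = ((Matrix.J (Fin n) ℝ i j : ℝ) : ℂ) := by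
    intro i j
    rcases i with i | i <;> rcases j with j | j <;> simp [Matrix.J, Matrix.one_apply, apply_ite]
  have h : (classicalCov (wigner ħ ρ)).map Complex.ofReal +
      (Complex.I * (ħ : ℂ)) • Matrix.J (Fin n) ℂ = (2 : ℂ) • (Matrix.gram ℂ C).transpose := by
    ext i j
    have h1 : ⟪C j, C i⟫_ℂ = conj ⟪C i, C j⟫_ℂ := (inner_conj_symm _ _).symm
    rw [Matrix.add_apply, Matrix.map_apply, Matrix.smul_apply, Matrix.smul_apply,
      Matrix.transpose_apply, Matrix.gram_apply, h1, hCC, hJ]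
    simp only [map_sub, map_mul, Complex.conj_I, Complex.conj_ofReal, smul_eq_mul]
    push_cast
    ring
  rw [h]
  exact ((Matrix.posSemidef_gram ℂ C).transpose).smul (by norm_num)

end Moments

/-! ### Gaussian states -/

section Gaussian

variable {n : ℕ}

theorem abs_coord_le (i : Fin n ⊕ Fin n) (z : PhaseSpace n) : |coord i z| ≤ ‖z‖ := by
  rcases i with k | k
  · exact (PiLp.norm_apply_le z.1 k).trans (norm_fst_le z)
  · exact (PiLp.norm_apply_le z.2 k).trans (norm_snd_le z)

/-- The quadratic form of a matrix on phase space. -/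
def quadForm (M : Matrix (Fin n ⊕ Fin n) (Fin n ⊕ Fin n) ℝ) (z : PhaseSpace n) : ℝ :=
  (fun i => coord i z) ⬝ᵥ M.mulVec fun i => coord i z

theorem continuous_quadForm (M : Matrix (Fin n ⊕ Fin n) (Fin n ⊕ Fin n) ℝ) :
    Continuous (quadForm M) := by
  have h : Continuous fun z : PhaseSpace n => fun i => coord i z :=
    continuous_pi fun i => continuous_coord i
  exact h.dotProduct (continuous_const.matrix_mulVec h)

theorem coord_smul (t : ℝ) (i : Fin n ⊕ Fin n) (z : PhaseSpace n) :
    coord i (t • z) = t * coord i z := by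
  rcases i with k | k <;> simp [coord]

theorem quadForm_smul (M : Matrix (Fin n ⊕ Fin n) (Fin n ⊕ Fin n) ℝ) (t : ℝ)
    (z : PhaseSpace n) : quadForm M (t • z) = t ^ 2 * quadForm M z := by
  have h : (fun i => coord i (t • z)) = t • fun i => coord i z := by
    ext i
    simp [coord_smul]
  rw [quadForm, h, Matrix.mulVec_smul, smul_dotProduct, dotProduct_smul, quadForm, smul_eq_mul,
    smul_eq_mul]
  ring

/-- Compactness of the unit sphere gives a positive minimum, and homogeneity of degree two extends
the bound to all z. -/
theorem exists_le_quadForm {M : Matrix (Fin n ⊕ Fin n) (Fin n ⊕ Fin n) ℝ} (hM : M.PosDef) :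
    ∃ c > 0, ∀ z, c * ‖z‖ ^ 2 ≤ quadForm M z := by
  obtain ⟨c, hc, h⟩ := (isCompact_sphere (0 : PhaseSpace n) 1).exists_forall_le'
    (continuous_quadForm M).continuousOn (a := 0) (fun z hz => by
      have hv : (fun i => coord i z) ≠ 0 := by
        intro h0
        have hz0 : z = 0 := by
          ext k
          · exact congrFun h0 (Sum.inl k)
          · exact congrFun h0 (Sum.inr k)
        simp [hz0] at hz
      have h1 := hM.dotProduct_mulVec_pos hv
      rw [star_trivial] at h1
      exact h1)
  refine ⟨c, hc, fun z => ?_⟩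
  rcases eq_or_ne z 0 with rfl | hz
  · have := quadForm_smul M 0 0
    simp at this
    simp [this]
  have hz' : ‖z‖ ≠ 0 := norm_ne_zero_iff.2 hz
  have h1 := h (‖z‖⁻¹ • z) (by simp [norm_smul, hz'])
  rw [quadForm_smul, inv_pow, ← div_eq_inv_mul, le_div_iff₀ (by positivity)] at h1
  exact h1

theorem integrable_one_add_norm_sq_mul_exp {c : ℝ} (hc : 0 < c) :
    Integrable fun z : PhaseSpace n => (1 + ‖z‖ ^ 2) * Real.exp (-(1 / 2) * (c * ‖z‖ ^ 2)) := by
  have hg : Integrable fun x : Config n => Real.exp (-(c / 8) * ‖x‖ ^ 2) := by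
    have h := (GaussianFourier.integrable_cexp_neg_mul_sq_norm_add (V := Config n) (b := (c / 8 : ℝ))
      (by rw [Complex.ofReal_re]; positivity) 0 0).re
    refine h.congr (.of_forall fun x => ?_)
    simp only [zero_mul, add_zero]
    rw [← Complex.ofReal_pow, ← Complex.ofReal_neg, ← Complex.ofReal_mul, ← Complex.ofReal_exp]
    exact Complex.ofReal_re _
  have hp := (hg.mul_prod hg).const_mul (1 + 4 / c)
  rw [← Measure.volume_eq_prod] at hp
  refine hp.mono' (Continuous.aestronglyMeasurable (by fun_prop)) (.of_forall fun z => ?_)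
  rw [Real.norm_of_nonneg (by positivity)]
  have h1 : ‖z.1‖ ^ 2 ≤ ‖z‖ ^ 2 := by gcongr; exact norm_fst_le z
  have h2 : ‖z.2‖ ^ 2 ≤ ‖z‖ ^ 2 := by gcongr; exact norm_snd_le z
  -- The polynomial factor costs half of the Gaussian decay. The other half, c‖z‖²/4, is split
  -- evenly between q and p, because the norm on the product is the maximum; hence the rate c/8.
  have h3 : 1 + ‖z‖ ^ 2 ≤ (1 + 4 / c) * Real.exp (c / 4 * ‖z‖ ^ 2) := by
    have h4 := Real.add_one_le_exp (c / 4 * ‖z‖ ^ 2)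
    calc 1 + ‖z‖ ^ 2 ≤ (1 + 4 / c) * (c / 4 * ‖z‖ ^ 2 + 1) := by
          have : (1 + 4 / c) * (c / 4 * ‖z‖ ^ 2 + 1) =
            1 + ‖z‖ ^ 2 + (c / 4 * ‖z‖ ^ 2 + 4 / c) := by field_simp; ring
          rw [this]
          have : 0 ≤ c / 4 * ‖z‖ ^ 2 + 4 / c := by positivity
          linarith
      _ ≤ _ := by gcongr
  calc (1 + ‖z‖ ^ 2) * Real.exp (-(1 / 2) * (c * ‖z‖ ^ 2))
      ≤ (1 + 4 / c) * Real.exp (c / 4 * ‖z‖ ^ 2) * Real.exp (-(1 / 2) * (c * ‖z‖ ^ 2)) := by gcongr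
    _ = (1 + 4 / c) * Real.exp (c / 4 * ‖z‖ ^ 2 + -(1 / 2) * (c * ‖z‖ ^ 2)) := by
        rw [Real.exp_add]; ring
    _ ≤ (1 + 4 / c) * Real.exp (-(c / 8) * ‖z.1‖ ^ 2 + -(c / 8) * ‖z.2‖ ^ 2) := by
        refine mul_le_mul_of_nonneg_left (Real.exp_le_exp.2 ?_) (by positivity)
        linarith [mul_le_mul_of_nonneg_left h1 hc.le, mul_le_mul_of_nonneg_left h2 hc.le]
    _ = _ := by rw [Real.exp_add]

/-- Gaussian functions on phase space have finite second moments. -/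
theorem classicalSecondMomentsFinite_gaussian {M : Matrix (Fin n ⊕ Fin n) (Fin n ⊕ Fin n) ℝ}
    (hM : M.PosDef) (c : ℝ) (δ : PhaseSpace n) :
    ClassicalSecondMomentsFinite fun z : PhaseSpace n =>
      c * Real.exp (-(1 / 2) * quadForm M (z - δ)) := by
  obtain ⟨a, ha, hle⟩ := exists_le_quadForm hM
  have hQ := continuous_quadForm M
  have key : ∀ f : PhaseSpace n → ℝ, Continuous f → (∀ z, |f z| ≤ 1 + ‖z‖ ^ 2) →
      Integrable fun z => c * Real.exp (-(1 / 2) * quadForm M (z - δ)) * f z := by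
    intro f hf hb
    have hinv : (volume : Measure (PhaseSpace n)).IsAddRightInvariant := by
      rw [Measure.volume_eq_prod]
      infer_instance
    have hg := ((integrable_one_add_norm_sq_mul_exp (n := n) ha).comp_sub_right δ).const_mul
      (|c| * (2 + 2 * ‖δ‖ ^ 2))
    refine hg.mono' (Continuous.aestronglyMeasurable (by fun_prop)) (.of_forall fun z => ?_)
    rw [norm_mul, norm_mul, Real.norm_eq_abs, Real.norm_eq_abs, Real.norm_eq_abs, Real.abs_exp]
    have h1 : ‖z‖ ≤ ‖z - δ‖ + ‖δ‖ := by simpa using norm_add_le (z - δ) δ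
    -- The growth bound is recentred at δ through ‖z‖² ≤ 2‖z - δ‖² + 2‖δ‖².
    have h2 : |f z| ≤ (2 + 2 * ‖δ‖ ^ 2) * (1 + ‖z - δ‖ ^ 2) := by
      refine (hb z).trans ?_
      have h3 : ‖z‖ ^ 2 ≤ (‖z - δ‖ + ‖δ‖) ^ 2 := by gcongr
      nlinarith [sq_nonneg (‖z - δ‖ - ‖δ‖), mul_nonneg (sq_nonneg ‖δ‖) (sq_nonneg ‖z - δ‖)]
    calc |c| * Real.exp (-(1 / 2) * quadForm M (z - δ)) * |f z|
        ≤ |c| * Real.exp (-(1 / 2) * (a * ‖z - δ‖ ^ 2)) *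
          ((2 + 2 * ‖δ‖ ^ 2) * (1 + ‖z - δ‖ ^ 2)) := by
          have h4 := hle (z - δ)
          gcongr ?_ * Real.exp ?_ * ?_
          linarith
      _ = _ := by ring
  refine ⟨?_, fun i => key _ (continuous_coord i) fun z => ?_, fun i j =>
    key _ ((continuous_coord i).mul (continuous_coord j)) fun z => ?_⟩
  · simpa using key (fun _ => 1) continuous_const fun z => by
      rw [abs_one]; nlinarith [sq_nonneg ‖z‖]
  · nlinarith [abs_coord_le i z, sq_nonneg (‖z‖ - 1)]
  · rw [abs_mul]
    nlinarith [mul_le_mul (abs_coord_le i z) (abs_coord_le j z) (abs_nonneg _) (norm_nonneg z)]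

theorem IsGaussianState.classicalUncertaintyPrinciple {ρ : WaveSpace n →L[ℂ] WaveSpace n} {ħ : ℝ}
    (hħ : 0 < ħ) (h : IsGaussianState ħ ρ) : ClassicalUncertaintyPrinciple ħ (wigner ħ ρ) := by
  obtain ⟨hρ, c, d, M, hM, hW⟩ := h
  set δ : PhaseSpace n := (WithLp.toLp 2 fun k => d (Sum.inl k), WithLp.toLp 2 fun k => d (Sum.inr k))
  have hδ : ∀ z : PhaseSpace n, (fun i => coord i z - d i) = fun i => coord i (z - δ) := by
    intro z
    ext i
    rcases i with k | k <;> simp [coord, δ]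
  have hW' : wigner ħ ρ = fun z => c * Real.exp (-(1 / 2) * quadForm M (z - δ)) := by
    ext z
    rw [hW, hδ, quadForm]
  have hfin : ClassicalSecondMomentsFinite (wigner ħ ρ) := by
    rw [hW']
    exact classicalSecondMomentsFinite_gaussian hM c δ
  have h1 := integral_wigner hρ hħ hfin.1
  -- With c < 0 the Wigner function would be nonpositive, against its total mass one.
  have hc : 0 ≤ c := by
    by_contra hneg
    have h2 : ∫ z, wigner ħ ρ z ≤ 0 := integral_nonpos fun z => by
      rw [hW']
      exact mul_nonpos_of_nonpos_of_nonneg (not_le.1 hneg).le (Real.exp_pos _).le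
    linarith
  refine ⟨⟨fun z => ?_, hfin.1, h1⟩, hfin, posSemidef_classicalCov_add hħ hρ hfin⟩
  rw [hW']
  positivity

end Gaussian

end WignerCovariance

end

open WignerCovariance in
theorem mainTheorem6 (n : ℕ) (ħ : ℝ) (hħ : 0 < ħ) :
    (∀ ρ : WaveSpace n →L[ℂ] WaveSpace n, IsDensityOperator ρ →
      ClassicalSecondMomentsFinite (wigner ħ ρ) →
        QuantumSecondMomentsFinite ħ ρ ∧
        (∀ i : Fin n ⊕ Fin n, quantumMean ħ ρ i = (classicalMean (wigner ħ ρ) i : ℂ)) ∧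
        quantumCov ħ ρ = classicalCov (wigner ħ ρ)) ∧
    (∀ ρ : WaveSpace n →L[ℂ] WaveSpace n, IsGaussianState ħ ρ →
      ClassicalUncertaintyPrinciple ħ (wigner ħ ρ)) := by
  refine ⟨fun ρ hρ hW => ?_, fun ρ h => h.classicalUncertaintyPrinciple hħ⟩
  obtain ⟨h1, h2, -⟩ := quantum_moments_of_wigner hħ hρ hW
  exact ⟨h1, h2, quantumCov_eq_classicalCov hħ hρ hW⟩
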